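/- Let $\mathbf T=\mathbf R/2\pi\mathbf Z$, let $(e_k)_{k\ge0}$ be a complete orthonormal system of $L^2(\mathbf T)$ and let $Q$ be a self-adjoint operator on $L^2(\mathbf T)$ such that $\sum_{k\ge0}\|Qe_k\|_{L^\infty}^2<\infty$ (point values of $Qe_k$ refer to a fixed version bounded everywhere by $\|Qe_k\|_{L^\infty}$). For functions of $v\in[-1,1]$ put $\Pi\phi=\frac12\int_{-1}^1\phi(v)\,dv$ and $$\mathcal L\phi(v)=\int_{-1}^1 s(v,v')\,(\phi(v')-\phi(v))\,dv',$$ where $s$ is measurable and symmetric, $0<s_m\le s(v,v')\le s_M$, and $\int_{-1}^1 s(v,v')\,dv'=1$ for every $v$. Let $0<\sigma_m\le\sigma(x)\le\sigma_M$ for every $x\in\mathbf T$. Let $\varepsilon>0$, $\Delta t>0$, let $M\ge1$ be an integer, $\Delta x=2\pi/M$, $x_i=i\Delta x$, $x_{i+\frac12}=(i+\frac12)\Delta x$, with indices $i$ taken modulo $M$. Write $b_{ik}=Qe_k(x_i)$, $b_{i+\frac12,k}=Qe_k(x_{i+\frac12})$, $\sigma_{i+\frac12}=\sigma(x_{i+\frac12})$,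 $v^+=\max(v,0)$, $v^-=\min(v,0)$, and let $(\xi^n_k)_{n\ge1,k\ge0}$ be independent standard normal random variables. Consider the micro-macro scheme for the stochastic linear kinetic equation $df+\frac1\varepsilon v\,\partial_xf\,dt=\frac{\sigma}{\varepsilon^2}\mathcal Lf\,dt+f\circ Q\,dW_t$, with $\rho^n_i$ real-valued and $g^n_{i+\frac12}$ $L^2([-1,1])$-valued random variables: $$\rho_i^{n+1}=\rho_i^n-\Delta t\,\Pi\Big(v\,\tfrac{g^{n+1}_{i+\frac12}-g^{n+1}_{i-\frac12}}{\Delta x}\Big)+\rho_i^n\Big(\tfrac12\Delta t\sum_{k\ge0}b_{ik}^2+\sqrt{\Delta t}\sum_{k\ge0}b_{ik}\xi_k^{n+1}\Big),$$ $$\begin{aligned}g^{n+1}_{i+\frac12}={}&g^n_{i+\frac12}-\tfrac{\Delta t}{\varepsilon\Delta x}(I-\Pi)\Big(v^+(g^n_{i+\frac12}-g^n_{i-\frac12})+v^-(g^n_{i+\frac32}-g^n_{i+\frac12})\Big)+\tfrac{\sigma_{i+\frac12}}{\varepsilon^2}\,\mathcal Lg^{n+1}_{i+\frac12}\,\Delta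 t\\&+g^n_{i+\frac12}\Big(\tfrac12\Delta t\sum_{k\ge0}b_{i+\frac12,k}^2+\sqrt{\Delta t}\sum_{k\ge0}b_{i+\frac12,k}\xi^{n+1}_k\Big)-\tfrac1{\varepsilon^2}\,v\,\tfrac{\rho^n_{i+1}-\rho^n_i}{\Delta x}\,\Delta t,\end{aligned}$$ where the initial data $(\rho^0,g^0)$ are independent of the $\xi^n_k$ and $\Pi(g^0_{i+\frac12})=0$ for all $i$. For every $T>0$ there is a constant $C(T)$, depending only on $T$ and on the noise $((e_k)_k,Q)$ with its fixed point values, and in particular not on $\varepsilon$, $\Delta t$, $\Delta x$, $s$, $\sigma$ or the initial data, such that under the CFL condition $$\Delta t\le\frac{2s_m\sigma_m\Delta x^2}{2(2+\varepsilon)}+\frac{\varepsilon\Delta x}{2+\varepsilon}$$ every solution of the scheme satisfies, for every $n\ge 0$ with $n\Delta t\le T$, $$\mathbb E\Big[\sum_i(\rho_i^n)^2\Big]+\varepsilon^2\,\mathbb E\Big[\sum_i\Pi\big((g^n_{i+\frac12})^2\big)\Big]\le C(T)\Big(\mathbb E\Big[\sum_i(\rho_i^0)^2\Big]+\varepsilon^2\,\mathbb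 E\Big[\sum_i\Pi\big((g^0_{i+\frac12})^2\big)\Big]\Big).$$ So the scheme is stable on finite time intervals, uniformly in $\varepsilon$. -/

import Mathlib

open MeasureTheory ProbabilityTheory Filter Topology Set
open scoped ENNReal NNReal

noncomputable section

namespace KineticScheme

/-- The torus `𝐓 = ℝ / 2πℤ`. -/
abbrev Torus : Type := AddCircle (2 * Real.pi)

instance fact_two_pi_pos : Fact (0 < 2 * Real.pi) := ⟨Real.two_pi_pos⟩

/-- The real Hilbert space `L²(𝐓)` (with respect to the Lebesgue measure of total mass `2π`). -/
abbrev L2Torus : Type := Lp ℝ 2 (volume : Measure Torus)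

/-- Lebesgue measure on the velocity interval `[-1, 1]`. -/
def velMeasure : Measure ℝ := volume.restrict (Icc (-1) 1)

/-- The real Hilbert space `L²([-1, 1])` of velocity profiles. -/
abbrev L2Vel : Type := Lp ℝ 2 velMeasure

/-- The velocity average `Π φ = (1/2) ∫_{-1}^{1} φ(v) dv`. -/
def velAvg (φ : ℝ → ℝ) : ℝ := (1 / 2) * ∫ v, φ v ∂velMeasure

/-- The collision operator `(𝓛 φ)(v) = ∫_{-1}^{1} s(v, v') (φ(v') - φ(v)) dv'`. -/
def collision (s : ℝ → ℝ → ℝ) (φ : ℝ → ℝ) (v : ℝ) : ℝ :=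
  ∫ v', s v v' * (φ v' - φ v) ∂velMeasure

/-- The assumptions on the collision kernel `s` on `[-1, 1]²`: it is measurable, symmetric,
`0 < s_m ≤ s ≤ s_M`, and `∫_{-1}^{1} s(v, v') dv' = 1` for every `v`. -/
structure IsCollisionKernel (s : ℝ → ℝ → ℝ) (s_m s_M : ℝ) : Prop where
  measurable : Measurable (Function.uncurry s)
  pos : 0 < s_m
  lower : ∀ v ∈ Icc (-1 : ℝ) 1, ∀ v' ∈ Icc (-1 : ℝ) 1, s_m ≤ s v v'
  upper : ∀ v ∈ Icc (-1 : ℝ) 1, ∀ v' ∈ Icc (-1 : ℝ) 1, s v v' ≤ s_M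
  symm : ∀ v ∈ Icc (-1 : ℝ) 1, ∀ v' ∈ Icc (-1 : ℝ) 1, s v v' = s v' v
  normalized : ∀ v ∈ Icc (-1 : ℝ) 1, ∫ v', s v v' ∂velMeasure = 1

/-- The noise coefficient: `Q` is a self-adjoint operator on `L²(𝐓)` with
`∑ₖ ‖Q eₖ‖²_{L^∞} < ∞`, and `q k` is the version of `Q eₖ` whose point values enter the scheme.
A version is admissible if it is bounded at every point by the `L^∞` norm of `Q eₖ`; this is
automatic when `q k` is the continuous version. -/
structure IsNoiseCoefficient (e : HilbertBasis ℕ ℝ L2Torus) (Q : L2Torus →L[ℝ] L2Torus)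
    (q : ℕ → Torus → ℝ) : Prop where
  selfAdjoint : IsSelfAdjoint Q
  trace : ∑' k, eLpNorm (Q (e k)) ∞ volume ^ 2 < ∞
  version : ∀ k, q k =ᵐ[volume] Q (e k)
  bound : ∀ k x, ‖q k x‖ₑ ≤ eLpNorm (Q (e k)) ∞ volume

/-- The mesh size `Δx = 2π / M` of the grid with `M` points on the torus. -/
def meshSize (M : ℕ) : ℝ := 2 * Real.pi / M

/-- The grid node `x_i = i Δx`. The cyclic index set `ZMod M` encodes the extension by
periodicity. -/
def node (M : ℕ) (i : ZMod M) : Torus := (((i.val : ℝ) * meshSize M : ℝ) : Torus)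

/-- The staggered grid node `x_{i+1/2} = (i + 1/2) Δx`. -/
def halfNode (M : ℕ) (i : ZMod M) : Torus :=
  ((((i.val : ℝ) + 1 / 2) * meshSize M : ℝ) : Torus)

/-- The sum `∑_{k ≥ 0} bₖ ξₖ` of a random series, as the limit of its partial sums. For
`∑ bₖ² < ∞` and independent standard normal `ξₖ` it converges almost surely, but in general not
absolutely, so that the unconditional sum `∑'` would not be the right notion. -/
def seriesSum (b ξ : ℕ → ℝ) : ℝ :=
  limUnder atTop (fun K : ℕ => ∑ k ∈ Finset.range K, b k * ξ k)

/-- The factor `(1/2) Δt ∑ₖ bₖ² + √Δt ∑ₖ bₖ ξₖ` produced by the noise in one time step. -/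
def noiseFactor (Δt : ℝ) (b ξ : ℕ → ℝ) : ℝ :=
  (1 / 2) * Δt * (∑' k, b k ^ 2) + Real.sqrt Δt * seriesSum b ξ

/-- The upwind difference
`v⁺ (g_{i+1/2} - g_{i-1/2}) + v⁻ (g_{i+3/2} - g_{i+1/2})` at velocity `v`, where
`v⁺ = max(v, 0)` and `v⁻ = min(v, 0)`. The entry `g i` stands for `g_{i+1/2}`. -/
def upwind {M : ℕ} (g : ZMod M → L2Vel) (i : ZMod M) (v : ℝ) : ℝ :=
  max v 0 * (g i v - g (i - 1) v) + min v 0 * (g (i + 1) v - g i v)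

/-- One step of the micro-macro scheme from `(ρ, g)` to `(ρ', g')`, driven by `ξ`. The entries
`ρ i` and `g i` stand for `ρ_i` and `g_{i+1/2}`. The collision term is implicit, and the second
equation is an identity in `L²([-1, 1])`. -/
def SchemeStep {M : ℕ} (s : ℝ → ℝ → ℝ) (σ : Torus → ℝ) (q : ℕ → Torus → ℝ) (ε Δt : ℝ)
    (ξ : ℕ → ℝ) (ρ : ZMod M → ℝ) (g : ZMod M → L2Vel) (ρ' : ZMod M → ℝ)
    (g' : ZMod M → L2Vel) : Prop :=
  (∀ i, ρ' i = ρ i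
      - Δt * velAvg (fun v => v * ((g' i v - g' (i - 1) v) / meshSize M))
      + ρ i * noiseFactor Δt (fun k => q k (node M i)) ξ) ∧
  (∀ i, ∀ᵐ v ∂velMeasure, g' i v = g i v
      - Δt / (ε * meshSize M) * (upwind g i v - velAvg (upwind g i))
      + σ (halfNode M i) / ε ^ 2 * collision s (g' i) v * Δt
      + g i v * noiseFactor Δt (fun k => q k (halfNode M i)) ξ
      - 1 / ε ^ 2 * v * ((ρ (i + 1) - ρ i) / meshSize M) * Δt)

/-- `(ρⁿ, gⁿ)` is a solution of the scheme on the probability space `(Ω, P)`: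
the `ξ n k`, `n ≥ 1`, `k ≥ 0`, are independent standard normal variables; the initial data
`ρ⁰`, `g⁰` (`g⁰` with values in `L²([-1, 1])` and `Π g⁰ = 0`) are random and independent of
all of these; and every step of the scheme holds almost surely. -/
structure IsSolution {Ω : Type*} [mΩ : MeasurableSpace Ω] (P : Measure Ω) {M : ℕ}
    (s : ℝ → ℝ → ℝ) (σ : Torus → ℝ) (q : ℕ → Torus → ℝ) (ε Δt : ℝ)
    (ξ : ℕ → ℕ → Ω → ℝ) (ρ : ℕ → ZMod M → Ω → ℝ) (g : ℕ → ZMod M → Ω → L2Vel) : Prop where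
  measurable : ∀ n k, Measurable (ξ (n + 1) k)
  gaussian : ∀ n k, HasLaw (ξ (n + 1) k) (gaussianReal 0 1) P
  indep : iIndepFun (fun p : ℕ × ℕ => ξ (p.1 + 1) p.2) P
  initial : ∃ m₀ : MeasurableSpace Ω, m₀ ≤ mΩ ∧
    (∀ i, StronglyMeasurable[m₀] (ρ 0 i)) ∧ (∀ i, StronglyMeasurable[m₀] (g 0 i)) ∧
    Indep m₀ (⨆ p : ℕ × ℕ, MeasurableSpace.comap (ξ (p.1 + 1) p.2) inferInstance) P
  initial_mean : ∀ i, ∀ᵐ ω ∂P, velAvg (g 0 i ω) = 0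
  step : ∀ n, ∀ᵐ ω ∂P, SchemeStep s σ q ε Δt (fun k => ξ (n + 1) k ω)
    (fun i => ρ n i ω) (fun i => g n i ω) (fun i => ρ (n + 1) i ω) (fun i => g (n + 1) i ω)

/-- The energy `𝔼[∑ᵢ ρ_i²] + ε² 𝔼[∑ᵢ Π(g_{i+1/2}²)]`, as an element of `[0, ∞]`. -/
def energy {Ω : Type*} [MeasurableSpace Ω] (P : Measure Ω) {M : ℕ} [NeZero M] (ε : ℝ)
    (ρ : ZMod M → Ω → ℝ) (g : ZMod M → Ω → L2Vel) : ℝ≥0∞ :=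
  (∫⁻ ω, ENNReal.ofReal (∑ i, ρ i ω ^ 2) ∂P)
    + ENNReal.ofReal (ε ^ 2)
      * ∫⁻ ω, ENNReal.ofReal (∑ i, velAvg (fun v => (g i ω v) ^ 2)) ∂P

end KineticScheme

end

/-!
The proof is an energy estimate for one step, made pathwise first and averaged afterwards.

*Pathwise* (`SchemeStep.energy_le`). Write `r = Δt / Δx` and let `η` denote the noise factors. The
microscopic equation is tested with `2 ε² g'` and the macroscopic one is squared. Since `Π g' = 0`
is propagated by the scheme, the projection `I - Π` disappears, and the two coupling terms between
density and flux cancel after a summation by parts. The explicit upwind term is split by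
`g = g' - (g' - (1 + η) g) - η g`. The part with `g'` dissipates `ε r A`, where `A` is the sum of
`Π (|v| |g'_{i+1/2} - g'_{i-1/2}|²)`; the increment `g' - (1 + η) g` is absorbed exactly by the
square it leaves in the energy identity, and the noise part by Young's inequality. Together with
the squares and the noise terms of the macroscopic fluxes, bounded by Cauchy-Schwarz, this costs
`4/3 (1 + 1/2) r² A = 2 r² A`, while the spectral gap of the collision operator contributes
`4 s_m σ_m Δt ∑ Π (g'²) ≥ s_m σ_m Δt A`. The CFL condition gives
`2 r² ≤ ε r + s_m σ_m Δt`, so all of this is nonpositive, and the energy grows at most by the factors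
`growth η = (1 + η)² + 3 η²` in front of `ρ_i²` and `Π (g_{i+1/2}²)`.

*In expectation* (`IsSolution.energy_succ_le`). The noise factor is
`η = Δt B / 2 + √Δt S` with `B = ∑ b_k² ≤ Γ = ∑ ‖Q e_k‖²_∞`, where the Gaussian series `S` is centred
with `𝔼 S² ≤ B` (`exists_seriesSum`: martingale convergence and Fatou's lemma). Hence
`𝔼 (growth η) ≤ 1 + 5 Γ Δt + (Γ Δt)² ≤ exp (5 Γ Δt)`. The factor may be averaged separately because
`ρⁿ` and `gⁿ` are, up to null sets, functions of the initial data and the earlier noise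
(`IsSolution.exists_adapted`); this uses that the implicit collision term can be inverted on
`L²([-1, 1])` by the Lax-Milgram theorem. Iterating over `n ≤ T / Δt` steps gives the constant
`exp (5 Γ T)`.
-/

noncomputable section

namespace KineticScheme

/-! ### Velocity averages and the collision operator -/

instance isFiniteMeasure_velMeasure : IsFiniteMeasure velMeasure := by
  unfold velMeasure; infer_instance

lemma ae_mem_Icc_velMeasure : ∀ᵐ v ∂velMeasure, v ∈ Icc (-1 : ℝ) 1 :=
  ae_restrict_mem measurableSet_Icc

lemma velMeasure_real_univ : velMeasure.real univ = 2 := by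
  simp [velMeasure, Measure.real]; norm_num

lemma integral_velMeasure (φ : ℝ → ℝ) : ∫ v, φ v ∂velMeasure = ∫ v in (-1 : ℝ)..1, φ v := by
  rw [velMeasure, integral_Icc_eq_integral_Ioc, intervalIntegral.integral_of_le (by norm_num)]

lemma integral_id_velMeasure : ∫ v, v ∂velMeasure = 0 := by
  rw [integral_velMeasure]; simp

lemma integral_abs_velMeasure : ∫ v, |v| ∂velMeasure = 1 := by
  rw [integral_velMeasure, ← intervalIntegral.integral_add_adjacent_intervals (b := 0)
    (continuous_abs.intervalIntegrable _ _) (continuous_abs.intervalIntegrable _ _),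
    intervalIntegral.integral_congr (g := fun v => -v) (a := -1),
    intervalIntegral.integral_congr (g := fun v => v) (a := 0)]
  · rw [intervalIntegral.integral_neg]; simp; norm_num
  · intro x hx
    rw [uIcc_of_le (by norm_num)] at hx
    exact abs_of_nonneg hx.1
  · intro x hx
    rw [uIcc_of_le (by norm_num)] at hx
    exact abs_of_nonpos hx.2

/-- Multiplying by a function which is bounded on `[-1, 1]` preserves `L^p`. -/
lemma memLp_bdd_mul {p : ℝ≥0∞} {w f : ℝ → ℝ} (C : ℝ) (hw : Measurable w)
    (hC : ∀ v ∈ Icc (-1 : ℝ) 1, |w v| ≤ C) (hf : MemLp f p velMeasure) :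
    MemLp (fun v => w v * f v) p velMeasure := by
  refine MemLp.of_le_mul (c := C) hf (hw.aestronglyMeasurable.mul hf.1) ?_
  filter_upwards [ae_mem_Icc_velMeasure] with v hv
  rw [norm_mul]
  exact mul_le_mul_of_nonneg_right (hC v hv) (norm_nonneg _)

lemma abs_le_one_of_mem {v : ℝ} (hv : v ∈ Icc (-1 : ℝ) 1) : |v| ≤ 1 := abs_le.2 hv

lemma memLp_id_mul {p : ℝ≥0∞} {f : ℝ → ℝ} (hf : MemLp f p velMeasure) :
    MemLp (fun v => v * f v) p velMeasure :=
  memLp_bdd_mul 1 measurable_id (fun _ hv => abs_le_one_of_mem hv) hf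

lemma memLp_abs_mul {p : ℝ≥0∞} {f : ℝ → ℝ} (hf : MemLp f p velMeasure) :
    MemLp (fun v => |v| * f v) p velMeasure :=
  memLp_bdd_mul 1 measurable_id.abs (fun _ hv => by rw [abs_abs]; exact abs_le_one_of_mem hv) hf

/-- Cauchy-Schwarz for the weight `|v|`, which has total mass `1` on `[-1, 1]`. -/
lemma sq_integral_id_mul_le {f : ℝ → ℝ} (hf : MemLp f 2 velMeasure) :
    (∫ v, v * f v ∂velMeasure) ^ 2 ≤ ∫ v, |v| * f v ^ 2 ∂velMeasure := by
  set J := ∫ v, v * f v ∂velMeasure with hJ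
  have h1 : Integrable (fun v => v * f v) velMeasure := (memLp_id_mul hf).integrable one_le_two
  have h2 : Integrable (fun v => |v| * f v ^ 2) velMeasure :=
    memLp_one_iff_integrable.1 (memLp_abs_mul (memLp_one_iff_integrable.2 hf.integrable_sq))
  have h3 : Integrable (fun v : ℝ => |v|) velMeasure := by
    simpa using (memLp_abs_mul (memLp_const (μ := velMeasure) (p := 1) (1 : ℝ))).integrable le_rfl
  -- integrate `0 ≤ |v| (f v - sign v * J) ^ 2`, in the form `2 J v f ≤ |v| f² + J² |v|`
  have key : ∫ v, 2 * J * (v * f v) ∂velMeasure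
      ≤ ∫ v, (|v| * f v ^ 2 + J ^ 2 * |v|) ∂velMeasure := by
    refine integral_mono (h1.const_mul _) (h2.add (h3.const_mul _)) fun v => ?_
    rcases abs_cases v with ⟨h, h'⟩ | ⟨h, h'⟩ <;> simp only [h]
    · nlinarith [mul_nonneg h' (sq_nonneg (f v - J))]
    · nlinarith [mul_nonneg (neg_nonneg.2 h'.le) (sq_nonneg (f v + J))]
  rw [integral_const_mul, integral_add h2 (h3.const_mul _), integral_const_mul,
    integral_abs_velMeasure, ← hJ] at key
  nlinarith

namespace IsCollisionKernel

variable {s : ℝ → ℝ → ℝ} {s_m s_M : ℝ}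

lemma abs_le (hs : IsCollisionKernel s s_m s_M) {v v' : ℝ} (hv : v ∈ Icc (-1 : ℝ) 1)
    (hv' : v' ∈ Icc (-1 : ℝ) 1) : |s v v'| ≤ s_M := by
  rw [abs_of_nonneg (hs.pos.le.trans (hs.lower v hv v' hv'))]
  exact hs.upper v hv v' hv'

lemma integrable_mul (hs : IsCollisionKernel s s_m s_M) {φ : ℝ → ℝ}
    (hφ : Integrable φ velMeasure) {v : ℝ} (hv : v ∈ Icc (-1 : ℝ) 1) :
    Integrable (fun v' => s v v' * φ v') velMeasure :=
  memLp_one_iff_integrable.1 <| memLp_bdd_mul s_M (hs.measurable.comp measurable_prodMk_left)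
    (fun _ hv' => hs.abs_le hv hv') (memLp_one_iff_integrable.2 hφ)

lemma collision_eq (hs : IsCollisionKernel s s_m s_M) {φ : ℝ → ℝ}
    (hφ : Integrable φ velMeasure) {v : ℝ} (hv : v ∈ Icc (-1 : ℝ) 1) :
    collision s φ v = (∫ v', s v v' * φ v' ∂velMeasure) - φ v := by
  have h1 : Integrable (fun v' => s v v' * φ v) velMeasure :=
    hs.integrable_mul (integrable_const _) hv
  simp only [collision, mul_sub]
  rw [integral_sub (hs.integrable_mul hφ hv) h1, integral_mul_const, hs.normalized v hv, one_mul]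

lemma abs_integral_mul_le (hs : IsCollisionKernel s s_m s_M) {φ : ℝ → ℝ}
    (hφ : Integrable φ velMeasure) {v : ℝ} (hv : v ∈ Icc (-1 : ℝ) 1) :
    |∫ v', s v v' * φ v' ∂velMeasure| ≤ s_M * ∫ v', |φ v'| ∂velMeasure := by
  rw [← integral_const_mul]
  refine (abs_integral_le_integral_abs).trans
    (integral_mono_ae (hs.integrable_mul hφ hv).abs (hφ.abs.const_mul _) ?_)
  filter_upwards [ae_mem_Icc_velMeasure] with v' hv'
  rw [abs_mul]
  exact mul_le_mul_of_nonneg_right (hs.abs_le hv hv') (abs_nonneg _)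

lemma aestronglyMeasurable_integral_mul (hs : IsCollisionKernel s s_m s_M) {φ : ℝ → ℝ}
    (hφ : AEStronglyMeasurable φ velMeasure) :
    AEStronglyMeasurable (fun v => ∫ v', s v v' * φ v' ∂velMeasure) velMeasure :=
  AEStronglyMeasurable.integral_prod_right' (f := fun p : ℝ × ℝ => s p.1 p.2 * φ p.2)
    (hs.measurable.aestronglyMeasurable.mul
      (hφ.comp_quasiMeasurePreserving Measure.quasiMeasurePreserving_snd))

/-- The gain part `φ ↦ ∫ s(v, v') φ(v') dv'` of the collision operator maps into `L^∞`. -/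
lemma memLp_integral_mul (hs : IsCollisionKernel s s_m s_M) {φ : ℝ → ℝ} {p : ℝ≥0∞}
    (hφ : Integrable φ velMeasure) :
    MemLp (fun v => ∫ v', s v v' * φ v' ∂velMeasure) p velMeasure := by
  refine MemLp.of_bound (hs.aestronglyMeasurable_integral_mul hφ.1)
    (s_M * ∫ v', |φ v'| ∂velMeasure) ?_
  filter_upwards [ae_mem_Icc_velMeasure] with v hv
  exact hs.abs_integral_mul_le hφ hv

lemma memLp_collision (hs : IsCollisionKernel s s_m s_M) {φ : ℝ → ℝ} (hφ : MemLp φ 2 velMeasure) :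
    MemLp (collision s φ) 2 velMeasure := by
  have hi := hφ.integrable one_le_two
  refine (memLp_congr_ae ?_).1 ((hs.memLp_integral_mul (p := 2) hi).sub hφ)
  filter_upwards [ae_mem_Icc_velMeasure] with v hv
  exact (hs.collision_eq hi hv).symm

lemma ae_prod_mem : ∀ᵐ p ∂(velMeasure.prod velMeasure),
    p.1 ∈ Icc (-1 : ℝ) 1 ∧ p.2 ∈ Icc (-1 : ℝ) 1 :=
  (Measure.quasiMeasurePreserving_fst.ae ae_mem_Icc_velMeasure).and
    (Measure.quasiMeasurePreserving_snd.ae ae_mem_Icc_velMeasure)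

lemma integrable_prod_mul (hs : IsCollisionKernel s s_m s_M) {G : ℝ × ℝ → ℝ}
    (hG : Integrable G (velMeasure.prod velMeasure)) :
    Integrable (fun p => s p.1 p.2 * G p) (velMeasure.prod velMeasure) := by
  refine Integrable.bdd_mul (c := s_M) hG hs.measurable.aestronglyMeasurable ?_
  filter_upwards [ae_prod_mem] with p hp
  exact hs.abs_le hp.1 hp.2

lemma integrable_prod_mul_sub {ψ φ : ℝ → ℝ} (hψ : MemLp ψ 2 velMeasure)
    (hφ : MemLp φ 2 velMeasure) :
    Integrable (fun p : ℝ × ℝ => ψ p.1 * (φ p.2 - φ p.1)) (velMeasure.prod velMeasure) := by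
  have h1 := (hψ.integrable one_le_two).mul_prod (hφ.integrable one_le_two)
  have h2 := (hψ.integrable_mul hφ).mul_prod (integrable_const (μ := velMeasure) (1 : ℝ))
  refine (h1.sub h2).congr (Eventually.of_forall fun p => ?_)
  simp; ring

/-- The bilinear form of the collision operator as a double integral. -/
lemma integral_mul_collision (hs : IsCollisionKernel s s_m s_M) {ψ φ : ℝ → ℝ}
    (hψ : MemLp ψ 2 velMeasure) (hφ : MemLp φ 2 velMeasure) :
    ∫ v, ψ v * collision s φ v ∂velMeasure
      = ∫ p, s p.1 p.2 * (ψ p.1 * (φ p.2 - φ p.1)) ∂(velMeasure.prod velMeasure) := by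
  rw [integral_prod _ (hs.integrable_prod_mul (integrable_prod_mul_sub hψ hφ))]
  refine integral_congr_ae (Eventually.of_forall fun v => ?_)
  simp only [collision]
  rw [← integral_const_mul]
  congr 1; ext v'; ring

/-- Exchanging `v` and `v'` symmetrizes the bilinear form of the collision operator. -/
lemma two_mul_integral_mul_collision (hs : IsCollisionKernel s s_m s_M) {ψ φ : ℝ → ℝ}
    (hψ : MemLp ψ 2 velMeasure) (hφ : MemLp φ 2 velMeasure) :
    2 * ∫ v, ψ v * collision s φ v ∂velMeasure
      = -∫ p, s p.1 p.2 * ((ψ p.2 - ψ p.1) * (φ p.2 - φ p.1))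
          ∂(velMeasure.prod velMeasure) := by
  have hI := hs.integrable_prod_mul (integrable_prod_mul_sub hψ hφ)
  have hsw := integral_prod_swap (μ := velMeasure) (ν := velMeasure)
    (fun p : ℝ × ℝ => s p.1 p.2 * (ψ p.1 * (φ p.2 - φ p.1)))
  rw [hs.integral_mul_collision hψ hφ, two_mul]
  nth_rewrite 2 [← hsw]
  have hJ : Integrable (fun p : ℝ × ℝ =>
      s p.swap.1 p.swap.2 * (ψ p.swap.1 * (φ p.swap.2 - φ p.swap.1)))
      (velMeasure.prod velMeasure) := hI.swap
  rw [← integral_add hI hJ, ← integral_neg]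
  refine integral_congr_ae ?_
  filter_upwards [ae_prod_mem] with p hp
  simp only [Prod.fst_swap, Prod.snd_swap]
  rw [hs.symm p.2 hp.2 p.1 hp.1]
  ring

/-- Collisions conserve mass. -/
lemma integral_collision (hs : IsCollisionKernel s s_m s_M) {φ : ℝ → ℝ}
    (hφ : MemLp φ 2 velMeasure) : ∫ v, collision s φ v ∂velMeasure = 0 := by
  have h := hs.two_mul_integral_mul_collision (memLp_const (1 : ℝ)) hφ
  simp only [one_mul, sub_self, zero_mul, mul_zero, integral_zero, neg_zero] at h
  linarith

lemma integral_mul_collision_nonpos (hs : IsCollisionKernel s s_m s_M) {φ : ℝ → ℝ}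
    (hφ : MemLp φ 2 velMeasure) : ∫ v, φ v * collision s φ v ∂velMeasure ≤ 0 := by
  have h := hs.two_mul_integral_mul_collision hφ hφ
  have : 0 ≤ ∫ p, s p.1 p.2 * ((φ p.2 - φ p.1) * (φ p.2 - φ p.1))
      ∂(velMeasure.prod velMeasure) := by
    refine integral_nonneg_of_ae ?_
    filter_upwards [ae_prod_mem] with p hp
    exact mul_nonneg (hs.pos.le.trans (hs.lower _ hp.1 _ hp.2)) (mul_self_nonneg _)
  linarith

/-- The spectral gap of the collision operator on functions of zero mean. -/
lemma integral_mul_collision_le (hs : IsCollisionKernel s s_m s_M) {φ : ℝ → ℝ}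
    (hφ : MemLp φ 2 velMeasure) (h0 : ∫ v, φ v ∂velMeasure = 0) :
    ∫ v, φ v * collision s φ v ∂velMeasure ≤ -(2 * s_m * ∫ v, φ v ^ 2 ∂velMeasure) := by
  have h := hs.two_mul_integral_mul_collision hφ hφ
  have hi := hφ.integrable one_le_two
  have hc := integrable_const (μ := velMeasure) (1 : ℝ)
  have hsq := hφ.integrable_sq
  have e1 := hsq.mul_prod hc
  have e2 := hc.mul_prod hsq
  have e3 := (hi.mul_prod hi).const_mul 2
  have hG : Integrable (fun p : ℝ × ℝ => (φ p.2 - φ p.1) * (φ p.2 - φ p.1))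
      (velMeasure.prod velMeasure) := by
    refine ((e1.add e2).sub e3).congr (Eventually.of_forall fun p => ?_)
    simp; ring
  have hval : ∫ p, (φ p.2 - φ p.1) * (φ p.2 - φ p.1) ∂(velMeasure.prod velMeasure)
      = 4 * ∫ v, φ v ^ 2 ∂velMeasure := by
    have : (fun p : ℝ × ℝ => (φ p.2 - φ p.1) * (φ p.2 - φ p.1))
        = fun p => (φ p.1 ^ 2 * 1 + 1 * φ p.2 ^ 2) - 2 * (φ p.1 * φ p.2) := by
      ext p; ring
    have e12 : Integrable (fun p : ℝ × ℝ => φ p.1 ^ 2 * 1 + 1 * φ p.2 ^ 2)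
        (velMeasure.prod velMeasure) := e1.add e2
    rw [this, integral_sub e12 e3, integral_add e1 e2, integral_const_mul (2 : ℝ),
      integral_prod_mul (fun v => φ v ^ 2) (fun _ => (1 : ℝ)),
      integral_prod_mul (fun _ => (1 : ℝ)) (fun v => φ v ^ 2), integral_prod_mul φ φ, h0]
    simp [velMeasure_real_univ]; ring
  have hle : s_m * ∫ p, (φ p.2 - φ p.1) * (φ p.2 - φ p.1) ∂(velMeasure.prod velMeasure)
      ≤ ∫ p, s p.1 p.2 * ((φ p.2 - φ p.1) * (φ p.2 - φ p.1))
        ∂(velMeasure.prod velMeasure) := by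
    rw [← integral_const_mul]
    refine integral_mono_ae (hG.const_mul _) (hs.integrable_prod_mul hG) ?_
    filter_upwards [ae_prod_mem] with p hp
    exact mul_le_mul_of_nonneg_right (hs.lower _ hp.1 _ hp.2) (mul_self_nonneg _)
  rw [hval] at hle
  linarith

end IsCollisionKernel

/-! ### The pathwise energy estimate for one step -/

/-- The factor by which the square of an unknown multiplied by `1 + η` may grow in one step:
`(1 + η)²` plus the cost of absorbing the product of `η` with the implicit fluxes. -/
def growth (η : ℝ) : ℝ := (1 + η) ^ 2 + 3 * η ^ 2

lemma growth_nonneg (η : ℝ) : 0 ≤ growth η := by unfold growth; positivity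

lemma sum_comp_add_right {M : ℕ} [NeZero M] (f : ZMod M → ℝ) (k : ZMod M) :
    ∑ i, f (i + k) = ∑ i, f i :=
  Equiv.sum_comp (Equiv.addRight k) f

/-- The upwind term at a velocity of modulus `a`, tested with the new profile. Summation by parts
moves the difference onto `y`; writing `x = y - (y - (1 + η) x) - η x`, the first part
dissipates and the other two are absorbed by Young's inequality. -/
lemma shift_dissipation {M : ℕ} [NeZero M] (k : ZMod M) (x y η : ZMod M → ℝ) {a ε r : ℝ}
    (ha0 : 0 ≤ a) (ha1 : a ≤ 1) :
    -(2 * ε * r) * ∑ i, y i * (a * (x i - x (i - k)))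
      ≤ ∑ i, (ε ^ 2 * (y i - (1 + η i) * x i) ^ 2 + 3 * ε ^ 2 * (η i * x i) ^ 2
        + (4 / 3 * r ^ 2 - ε * r) * (a * (y i - y (i - k)) ^ 2)) := by
  have hparts : ∑ i, y i * (a * (x i - x (i - k))) = ∑ i, a * (y i - y (i + k)) * x i := by
    have h := sum_comp_add_right (fun i => y i * (a * x (i - k))) k
    simp only [add_sub_cancel_right] at h
    have e1 : ∑ i, y i * (a * (x i - x (i - k)))
        = ∑ i, y i * (a * x i) - ∑ i, y i * (a * x (i - k)) := by
      rw [← Finset.sum_sub_distrib]; exact Finset.sum_congr rfl fun i _ => by ring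
    rw [e1, ← h, ← Finset.sum_sub_distrib]
    exact Finset.sum_congr rfl fun i _ => by ring
  have hdiss : ∑ i, (4 / 3 * r ^ 2 - ε * r) * (a * (y i - y (i - k)) ^ 2)
      = ∑ i, (4 / 3 * r ^ 2 - ε * r) * (a * (y (i + k) - y i) ^ 2) := by
    rw [← sum_comp_add_right _ k]
    simp only [add_sub_cancel_right]
  have htel : ∑ i, (ε * r * a) * (y i ^ 2 - y (i + k) ^ 2) = 0 := by
    rw [← Finset.mul_sum, Finset.sum_sub_distrib, sum_comp_add_right (fun i => y i ^ 2) k, sub_self,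
      mul_zero]
  rw [hparts, Finset.sum_add_distrib, hdiss, ← Finset.sum_add_distrib, Finset.mul_sum,
    ← add_zero (∑ i, (_ : ℝ)), ← htel, ← Finset.sum_add_distrib]
  refine Finset.sum_le_sum fun i _ => ?_
  have haa : a ^ 2 ≤ a := by nlinarith
  have h1 := mul_le_mul_of_nonneg_right haa (mul_nonneg (sq_nonneg r) (sq_nonneg (y (i + k) - y i)))
  nlinarith [sq_nonneg (ε * (y i - (1 + η i) * x i) - r * a * (y i - y (i + k))),
    sq_nonneg (3 * ε * (η i * x i) - r * a * (y i - y (i + k)))]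

/-- The dissipation of the upwind discretization at a fixed velocity `v ∈ [-1, 1]`, up to the terms
produced by its explicit treatment. -/
lemma upwind_dissipation {M : ℕ} [NeZero M] (x y η : ZMod M → ℝ) {v ε r : ℝ} (hv : |v| ≤ 1) :
    -(2 * ε * r) * ∑ i, y i * (max v 0 * (x i - x (i - 1)) + min v 0 * (x (i + 1) - x i))
      ≤ ∑ i, (ε ^ 2 * (y i - (1 + η i) * x i) ^ 2 + 3 * ε ^ 2 * (η i * x i) ^ 2
        + (4 / 3 * r ^ 2 - ε * r) * (|v| * (y i - y (i - 1)) ^ 2)) := by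
  rcases le_total 0 v with h | h
  · have := shift_dissipation 1 x y η (ε := ε) (r := r) (abs_nonneg v) hv
    simpa [max_eq_left h, min_eq_right h, abs_of_nonneg h] using this
  · have := shift_dissipation (-1) x y η (ε := ε) (r := r) (abs_nonneg v) hv
    simp only [sub_neg_eq_add] at this
    have e1 : ∑ i, y i * (max v 0 * (x i - x (i - 1)) + min v 0 * (x (i + 1) - x i))
        = ∑ i, y i * (|v| * (x i - x (i + 1))) :=
      Finset.sum_congr rfl fun i _ => by
        rw [max_eq_right h, min_eq_left h, abs_of_nonpos h]; ring
    have e2 : ∑ i, (4 / 3 * r ^ 2 - ε * r) * (|v| * (y i - y (i - 1)) ^ 2)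
        = ∑ i, (4 / 3 * r ^ 2 - ε * r) * (|v| * (y i - y (i + 1)) ^ 2) := by
      rw [← sum_comp_add_right _ 1]
      simp only [add_sub_cancel_right]
      exact Finset.sum_congr rfl fun i _ => by ring
    rw [e1, Finset.sum_add_distrib, e2, ← Finset.sum_add_distrib]
    exact this

lemma L2Vel.memLp (φ : L2Vel) : MemLp φ 2 velMeasure := Lp.memLp φ

lemma memLp_upwind {M : ℕ} (g : ZMod M → L2Vel) (i : ZMod M) :
    MemLp (upwind g i) 2 velMeasure := by
  refine MemLp.add (memLp_bdd_mul 1 (measurable_id.max measurable_const) (fun v hv => ?_)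
      ((Lp.memLp _).sub (Lp.memLp _)))
    (memLp_bdd_mul 1 (measurable_id.min measurable_const) (fun v hv => ?_)
      ((Lp.memLp _).sub (Lp.memLp _)))
  · rw [abs_of_nonneg (le_max_right _ _)]; exact max_le hv.2 zero_le_one
  · rw [abs_of_nonpos (min_le_right _ _)]
    exact neg_le.1 (le_min hv.1 (by norm_num))

section Step

variable {M : ℕ} {s : ℝ → ℝ → ℝ} {s_m s_M : ℝ} {σ : Torus → ℝ} {q : ℕ → Torus → ℝ} {ε Δt : ℝ}
  {ξ : ℕ → ℝ} {ρ ρ' : ZMod M → ℝ} {g g' : ZMod M → L2Vel}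

lemma integral_sub_add_add_sub {f₁ f₂ f₃ f₄ f₅ : ℝ → ℝ} {μ : Measure ℝ} (h₁ : Integrable f₁ μ)
    (h₂ : Integrable f₂ μ) (h₃ : Integrable f₃ μ) (h₄ : Integrable f₄ μ) (h₅ : Integrable f₅ μ) :
    ∫ v, f₁ v - f₂ v + f₃ v + f₄ v - f₅ v ∂μ = ((((∫ v, f₁ v ∂μ) - ∫ v, f₂ v ∂μ)
      + ∫ v, f₃ v ∂μ) + ∫ v, f₄ v ∂μ) - ∫ v, f₅ v ∂μ := by
  have e := integral_sub' (((h₁.sub h₂).add h₃).add h₄) h₅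
  rw [integral_add' ((h₁.sub h₂).add h₃) h₄, integral_add' (h₁.sub h₂) h₃,
    integral_sub' h₁ h₂] at e
  exact e

lemma velAvg_eq_zero_iff {φ : ℝ → ℝ} : velAvg φ = 0 ↔ ∫ v, φ v ∂velMeasure = 0 := by
  simp [velAvg]

/-- The scheme preserves the condition `Π g = 0`. -/
lemma SchemeStep.velAvg_eq_zero (h : SchemeStep s σ q ε Δt ξ ρ g ρ' g')
    (hs : IsCollisionKernel s s_m s_M) (h0 : ∀ i, velAvg (g i) = 0) (i : ZMod M) :
    velAvg (g' i) = 0 := by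
  rw [velAvg_eq_zero_iff, integral_congr_ae (h.2 i)]
  have hg : Integrable (g i) velMeasure := (L2Vel.memLp _).integrable one_le_two
  have hup : Integrable (fun v => upwind g i v - velAvg (upwind g i)) velMeasure :=
    ((memLp_upwind g i).integrable one_le_two).sub (integrable_const _)
  have hL : Integrable (collision s (g' i)) velMeasure :=
    (hs.memLp_collision (L2Vel.memLp _)).integrable one_le_two
  have hid : Integrable (fun v : ℝ => v) velMeasure := by
    simpa using (memLp_id_mul (memLp_const (μ := velMeasure) (p := 1) (1 : ℝ))).integrable le_rfl
  have h0' := velAvg_eq_zero_iff.1 (h0 i)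
  have i1 := hup.const_mul (Δt / (ε * meshSize M))
  have i2 := (hL.const_mul (σ (halfNode M i) / ε ^ 2)).mul_const Δt
  have i3 := hg.mul_const (noiseFactor Δt (fun k => q k (halfNode M i)) ξ)
  have i4 := ((hid.const_mul (1 / ε ^ 2)).mul_const ((ρ (i + 1) - ρ i) / meshSize M)).mul_const Δt
  have hodd : ∫ v, 1 / ε ^ 2 * v ∂velMeasure = 0 := by
    rw [integral_const_mul (1 / ε ^ 2) fun v => v, integral_id_velMeasure, mul_zero]
  rw [integral_sub_add_add_sub hg i1 i2 i3 i4]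
  simp only [integral_mul_const, hodd, integral_const_mul, h0',
    hs.integral_collision (L2Vel.memLp _)]
  rw [integral_sub ((memLp_upwind g i).integrable one_le_two) (integrable_const _)]
  simp [velAvg, velMeasure_real_univ]

variable [NeZero M]

/-- The energy balance of the microscopic equation. The last sum is the coupling with the
macroscopic density. -/
lemma SchemeStep.micro_energy (h : SchemeStep s σ q ε Δt ξ ρ g ρ' g')
    (hs : IsCollisionKernel s s_m s_M) {σ_m : ℝ} (hσm : 0 < σ_m) (hσ : ∀ x, σ_m ≤ σ x) (hε : 0 < ε)
    (hΔt : 0 < Δt) (h0 : ∀ i, velAvg (g' i) = 0) {r : ℝ} (hr : r = Δt / meshSize M) :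
    ε ^ 2 * ∑ i, ∫ v, g' i v ^ 2 ∂velMeasure
      ≤ ∑ i, (ε ^ 2 * growth (noiseFactor Δt (fun k => q k (halfNode M i)) ξ)
            * ∫ v, g i v ^ 2 ∂velMeasure
          + (4 / 3 * r ^ 2 - ε * r) * (∫ v, |v| * (g' i v - g' (i - 1) v) ^ 2 ∂velMeasure)
          - 4 * Δt * s_m * σ_m * (∫ v, g' i v ^ 2 ∂velMeasure)
          - 2 * r * (ρ (i + 1) - ρ i) * ∫ v, v * g' i v ∂velMeasure) := by
  set η : ZMod M → ℝ := fun i => noiseFactor Δt (fun k => q k (halfNode M i)) ξ with hη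
  set c : ZMod M → ℝ := fun i => velAvg (upwind g i) with hc
  have hmem : ∀ φ : L2Vel, MemLp φ 2 velMeasure := L2Vel.memLp
  have I1 : ∀ φ : L2Vel, Integrable (fun v => φ v ^ 2) velMeasure := fun φ => (hmem φ).integrable_sq
  have I2 : ∀ i, Integrable (fun v => |v| * (g' i v - g' (i - 1) v) ^ 2) velMeasure := fun i =>
    memLp_one_iff_integrable.1 <| memLp_abs_mul <| memLp_one_iff_integrable.2
      ((hmem (g' i)).sub (hmem (g' (i - 1)))).integrable_sq
  have I3 : ∀ i, Integrable (fun v => g' i v) velMeasure := fun i => (hmem _).integrable one_le_two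
  have I4 : ∀ i, Integrable (fun v => g' i v * collision s (g' i) v) velMeasure := fun i =>
    (hmem _).integrable_mul (hs.memLp_collision (hmem _))
  have I5 : ∀ i, Integrable (fun v => v * g' i v) velMeasure := fun i =>
    (memLp_id_mul (hmem _)).integrable one_le_two
  let R : ZMod M → ℝ → ℝ := fun i v => ε ^ 2 * growth (η i) * g i v ^ 2
    - 2 * r * (ρ (i + 1) - ρ i) * (v * g' i v)
    + (4 / 3 * r ^ 2 - ε * r) * (|v| * (g' i v - g' (i - 1) v) ^ 2)
    + 2 * ε * r * c i * g' i v
    - -(2 * Δt * σ (halfNode M i)) * (g' i v * collision s (g' i) v)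
  have J1 := fun i => (I1 (g i)).const_mul (ε ^ 2 * growth (η i))
  have J2 := fun i => (I2 i).const_mul (4 / 3 * r ^ 2 - ε * r)
  have J3 := fun i => (I3 i).const_mul (2 * ε * r * c i)
  have J4 := fun i => (I4 i).const_mul (-(2 * Δt * σ (halfNode M i)))
  have J5 := fun i => (I5 i).const_mul (2 * r * (ρ (i + 1) - ρ i))
  have hR : ∀ i, Integrable (R i) velMeasure := fun i =>
    ((((J1 i).sub (J5 i)).add (J2 i)).add (J3 i)).sub (J4 i)
  -- the balance at almost every fixed velocity
  have hpt : ∀ᵐ v ∂velMeasure, ε ^ 2 * ∑ i, g' i v ^ 2 ≤ ∑ i, R i v := by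
    filter_upwards [ae_mem_Icc_velMeasure, ae_all_iff.2 h.2] with v hv hstep
    have hup := upwind_dissipation (fun i => g i v) (fun i => g' i v) η (ε := ε) (r := r)
      (abs_le_one_of_mem hv)
    have hid : ∀ i, ε ^ 2 * g' i v ^ 2 = R i v - (ε ^ 2 * (g' i v - (1 + η i) * g i v) ^ 2
        + 3 * ε ^ 2 * (η i * g i v) ^ 2
        + (4 / 3 * r ^ 2 - ε * r) * (|v| * (g' i v - g' (i - 1) v) ^ 2))
        + -(2 * ε * r) * (g' i v * upwind g i v) := by
      intro i
      have e : ε ^ 2 * (g' i v - (1 + η i) * g i v) = -(ε * r) * (upwind g i v - c i)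
          + σ (halfNode M i) * Δt * collision s (g' i) v - r * v * (ρ (i + 1) - ρ i) := by
        rw [hstep i, hr]
        simp only [hη, hc]
        field_simp
        ring
      simp only [R, growth]
      linear_combination (2 * g' i v) * e
    rw [Finset.mul_sum, Finset.sum_congr rfl fun i _ => hid i, Finset.sum_add_distrib,
      Finset.sum_sub_distrib, ← Finset.mul_sum]
    simp only [upwind]
    linarith
  have hint := integral_mono_ae ((integrable_finsetSum Finset.univ fun i _ => I1 (g' i)).const_mul
    (ε ^ 2)) (integrable_finsetSum Finset.univ fun i _ => hR i) hpt
  rw [integral_const_mul, integral_finsetSum _ fun i _ => I1 (g' i),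
    integral_finsetSum _ fun i _ => hR i] at hint
  refine hint.trans (Finset.sum_le_sum fun i _ => ?_)
  have hRi : ∫ v, R i v ∂velMeasure = ε ^ 2 * growth (η i) * (∫ v, g i v ^ 2 ∂velMeasure)
      - 2 * r * (ρ (i + 1) - ρ i) * (∫ v, v * g' i v ∂velMeasure)
      + (4 / 3 * r ^ 2 - ε * r) * (∫ v, |v| * (g' i v - g' (i - 1) v) ^ 2 ∂velMeasure)
      + 2 * ε * r * c i * (∫ v, g' i v ∂velMeasure)
      - -(2 * Δt * σ (halfNode M i)) * (∫ v, g' i v * collision s (g' i) v ∂velMeasure) := by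
    simp only [← integral_const_mul]
    exact integral_sub_add_add_sub (J1 i) (J5 i) (J2 i) (J3 i) (J4 i)
  have hz := velAvg_eq_zero_iff.1 (h0 i)
  have hsq : 0 ≤ ∫ v, g' i v ^ 2 ∂velMeasure := integral_nonneg fun v => sq_nonneg _
  have hgap := hs.integral_mul_collision_le (hmem (g' i)) hz
  have hneg := hs.integral_mul_collision_nonpos (hmem (g' i))
  have hcol : σ (halfNode M i) * (∫ v, g' i v * collision s (g' i) v ∂velMeasure)
      ≤ -(2 * s_m * σ_m * ∫ v, g' i v ^ 2 ∂velMeasure) := by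
    nlinarith [mul_le_mul_of_nonneg_left hgap hσm.le,
      mul_le_mul_of_nonpos_right (hσ (halfNode M i)) hneg]
  rw [hRi, hz]
  nlinarith [mul_le_mul_of_nonneg_left hcol (mul_pos two_pos hΔt).le]

/-- The energy balance of the macroscopic equation. The last sum is the coupling with the
microscopic part, after a summation by parts. -/
lemma SchemeStep.macro_energy (h : SchemeStep s σ q ε Δt ξ ρ g ρ' g') {r : ℝ}
    (hr : r = Δt / meshSize M) :
    ∑ i, ρ' i ^ 2
      ≤ ∑ i, (growth (noiseFactor Δt (fun k => q k (node M i)) ξ) * ρ i ^ 2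
          + r ^ 2 / 3 * (∫ v, |v| * (g' i v - g' (i - 1) v) ^ 2 ∂velMeasure)
          + r * (ρ (i + 1) - ρ i) * ∫ v, v * g' i v ∂velMeasure) := by
  set η : ZMod M → ℝ := fun i => noiseFactor Δt (fun k => q k (node M i)) ξ with hη
  set J : ZMod M → ℝ := fun i => ∫ v, v * g' i v ∂velMeasure with hJ
  have hmem : ∀ φ : L2Vel, MemLp φ 2 velMeasure := L2Vel.memLp
  have hdiff : ∀ i, ∫ v, v * (g' i v - g' (i - 1) v) ∂velMeasure = J i - J (i - 1) := fun i => by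
    simp only [mul_sub]
    exact integral_sub ((memLp_id_mul (hmem _)).integrable one_le_two)
      ((memLp_id_mul (hmem _)).integrable one_le_two)
  have hstep : ∀ i, ρ' i = (1 + η i) * ρ i - r / 2 * (J i - J (i - 1)) := by
    intro i
    rw [h.1 i, velAvg]
    simp only [← mul_div_assoc]
    rw [integral_div, hdiff, hr]
    ring
  have hparts : ∑ i, r * (ρ (i + 1) - ρ i) * J i = ∑ i, -(r * ρ i * (J i - J (i - 1))) := by
    have h1 := sum_comp_add_right (fun i => r * ρ i * J (i - 1)) 1
    simp only [add_sub_cancel_right] at h1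
    have h2 : ∑ i, -(r * ρ i * (J i - J (i - 1)))
        = ∑ i, r * ρ i * J (i - 1) - ∑ i, r * ρ i * J i := by
      rw [← Finset.sum_sub_distrib]; exact Finset.sum_congr rfl fun i _ => by ring
    rw [h2, ← h1, ← Finset.sum_sub_distrib]
    exact Finset.sum_congr rfl fun i _ => by ring
  rw [Finset.sum_add_distrib (g := fun i => r * (ρ (i + 1) - ρ i) * J i), hparts,
    ← Finset.sum_add_distrib]
  refine Finset.sum_le_sum fun i _ => ?_
  have hCS := sq_integral_id_mul_le ((hmem (g' i)).sub (hmem (g' (i - 1))))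
  simp only [Pi.sub_apply] at hCS
  rw [hdiff] at hCS
  rw [hstep i]
  change _ ≤ growth (η i) * ρ i ^ 2 + _ + _
  unfold growth
  nlinarith [sq_nonneg (3 * η i * ρ i + r / 2 * (J i - J (i - 1))),
    mul_le_mul_of_nonneg_left hCS (sq_nonneg r)]

/-- **The pathwise energy estimate.** Under the CFL condition, one step of the scheme increases the
energy at most by the factors produced by the noise: the numerical dissipation and the
collisions absorb everything else. -/
theorem SchemeStep.energy_le (h : SchemeStep s σ q ε Δt ξ ρ g ρ' g')
    (hs : IsCollisionKernel s s_m s_M) {σ_m : ℝ} (hσm : 0 < σ_m) (hσ : ∀ x, σ_m ≤ σ x)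
    (hε : 0 < ε) (hΔt : 0 < Δt)
    (hCFL : Δt ≤ 2 * s_m * σ_m * meshSize M ^ 2 / (2 * (2 + ε)) + ε * meshSize M / (2 + ε))
    (h0 : ∀ i, velAvg (g' i) = 0) :
    ∑ i, ρ' i ^ 2 + ε ^ 2 * ∑ i, velAvg (fun v => g' i v ^ 2)
      ≤ ∑ i, growth (noiseFactor Δt (fun k => q k (node M i)) ξ) * ρ i ^ 2
        + ε ^ 2 * ∑ i, growth (noiseFactor Δt (fun k => q k (halfNode M i)) ξ)
          * velAvg (fun v => g i v ^ 2) := by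
  have hm : 0 < meshSize M := div_pos Real.two_pi_pos (Nat.cast_pos.2 (NeZero.pos M))
  obtain ⟨r, hr⟩ : ∃ r, r = Δt / meshSize M := ⟨_, rfl⟩
  have hmic := h.micro_energy hs hσm hσ hε hΔt h0 hr
  have hmac := h.macro_energy hr
  have hmem : ∀ φ : L2Vel, MemLp φ 2 velMeasure := L2Vel.memLp
  set A : ZMod M → ℝ := fun i => ∫ v, |v| * (g' i v - g' (i - 1) v) ^ 2 ∂velMeasure with hA
  set S : ZMod M → ℝ := fun i => ∫ v, g' i v ^ 2 ∂velMeasure with hS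
  have hA0 : 0 ≤ ∑ i, A i := Finset.sum_nonneg fun i _ =>
    integral_nonneg fun v => mul_nonneg (abs_nonneg v) (sq_nonneg _)
  have hAS : ∑ i, A i ≤ 4 * ∑ i, S i := by
    have h1 : ∀ i, A i ≤ 2 * S i + 2 * S (i - 1) := by
      intro i
      simp only [hA, hS]
      have j1 := (hmem (g' i)).integrable_sq.const_mul 2
      have j2 := (hmem (g' (i - 1))).integrable_sq.const_mul 2
      rw [← integral_const_mul, ← integral_const_mul, ← integral_add j1 j2]
      refine integral_mono_ae (memLp_one_iff_integrable.1 <| memLp_abs_mul <|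
        memLp_one_iff_integrable.2 ((hmem (g' i)).sub (hmem (g' (i - 1)))).integrable_sq)
        (j1.add j2) ?_
      filter_upwards [ae_mem_Icc_velMeasure] with v hv
      have := mul_le_mul_of_nonneg_right (abs_le_one_of_mem hv)
        (sq_nonneg (g' i v - g' (i - 1) v))
      nlinarith [sq_nonneg (g' i v + g' (i - 1) v)]
    have h2 := sum_comp_add_right (fun i => S (i - 1)) 1
    simp only [add_sub_cancel_right] at h2
    calc ∑ i, A i ≤ ∑ i, (2 * S i + 2 * S (i - 1)) := Finset.sum_le_sum fun i _ => h1 i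
      _ = 2 * ∑ i, S i + 2 * ∑ i, S (i - 1) := by
        rw [Finset.sum_add_distrib, Finset.mul_sum, Finset.mul_sum]
      _ = 4 * ∑ i, S i := by rw [← h2]; ring
  have hcfl : 2 * r ^ 2 - ε * r ≤ s_m * σ_m * Δt := by
    have h1 : Δt * (2 + ε) ≤ s_m * σ_m * meshSize M ^ 2 + ε * meshSize M := by
      have : 2 * s_m * σ_m * meshSize M ^ 2 / (2 * (2 + ε)) + ε * meshSize M / (2 + ε)
          = (s_m * σ_m * meshSize M ^ 2 + ε * meshSize M) / (2 + ε) := by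
        field_simp
      rwa [this, le_div_iff₀ (by positivity)] at hCFL
    have h2 : 2 * Δt ≤ s_m * σ_m * meshSize M ^ 2 + ε * meshSize M := by nlinarith
    have h3 : r * meshSize M = Δt := by rw [hr]; field_simp
    have hr0 : 0 < r := by rw [hr]; positivity
    rw [← h3] at h2 ⊢
    have h4 : 2 * r ≤ s_m * σ_m * meshSize M + ε := by
      by_contra! hlt
      nlinarith
    nlinarith
  -- the upwind terms contribute `4/3 r²` and the fluxes `2/3 r²` to the coefficient `2 r²`
  have hfinal : (2 * r ^ 2 - ε * r) * ∑ i, A i ≤ 4 * Δt * s_m * σ_m * ∑ i, S i := by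
    have hp : 0 < s_m * σ_m * Δt := mul_pos (mul_pos hs.pos hσm) hΔt
    nlinarith [mul_le_mul_of_nonneg_right hcfl hA0, mul_le_mul_of_nonneg_left hAS hp.le]
  simp only [Finset.sum_add_distrib, Finset.sum_sub_distrib] at hmic hmac
  simp only [velAvg]
  have e1 : ∑ i, 2 * r * (ρ (i + 1) - ρ i) * ∫ v, v * g' i v ∂velMeasure
      = 2 * ∑ i, r * (ρ (i + 1) - ρ i) * ∫ v, v * g' i v ∂velMeasure := by
    rw [Finset.mul_sum]; exact Finset.sum_congr rfl fun i _ => by ring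
  have e2 : ε ^ 2 * ∑ i, growth (noiseFactor Δt (fun k => q k (halfNode M i)) ξ)
        * (1 / 2 * ∫ v, g i v ^ 2 ∂velMeasure)
      = 1 / 2 * ∑ i, ε ^ 2 * growth (noiseFactor Δt (fun k => q k (halfNode M i)) ξ)
        * ∫ v, g i v ^ 2 ∂velMeasure := by
    rw [Finset.mul_sum, Finset.mul_sum]; exact Finset.sum_congr rfl fun i _ => by ring
  rw [e1, ← Finset.mul_sum, ← Finset.mul_sum] at hmic
  rw [← Finset.mul_sum (f := A)] at hmac
  rw [e2, ← Finset.mul_sum]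
  linarith

end Step

/-! ### The implicit step as a continuous operation on `L²([-1, 1])` -/

lemma inner_L2Vel (φ ψ : L2Vel) : inner ℝ φ ψ = ∫ v, φ v * ψ v ∂velMeasure := by
  rw [L2.inner_def]
  exact integral_congr_ae (Eventually.of_forall fun v => by simp [mul_comm])

lemma velAvg_sq (φ : L2Vel) : velAvg (fun v => φ v ^ 2) = 1 / 2 * ‖φ‖ ^ 2 := by
  rw [velAvg, ← real_inner_self_eq_norm_sq, inner_L2Vel]
  simp only [sq]

/-- The profile `v ↦ v` as an element of `L²([-1, 1])`. -/
def idVel : L2Vel :=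
  MemLp.toLp (fun v => v) (by simpa using memLp_id_mul (memLp_const (p := 2) (1 : ℝ)))

lemma coeFn_idVel : idVel =ᵐ[velMeasure] fun v => v := MemLp.coeFn_toLp _

/-- The constant profile `1` as an element of `L²([-1, 1])`. -/
def oneVel : L2Vel := MemLp.toLp (fun _ => 1) (memLp_const 1)

lemma coeFn_oneVel : oneVel =ᵐ[velMeasure] fun _ => (1 : ℝ) := MemLp.coeFn_toLp _

lemma integral_eq_inner_oneVel (φ : L2Vel) : ∫ v, φ v ∂velMeasure = inner ℝ oneVel φ := by
  rw [inner_L2Vel]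
  refine integral_congr_ae ?_
  filter_upwards [coeFn_oneVel] with v hv
  rw [hv, one_mul]

/-- Multiplication by a function which is bounded on `[-1, 1]`, as an operator on
`L²([-1, 1])`. -/
def mulVel (w : ℝ → ℝ) (hw : MemLp w ∞ velMeasure) : L2Vel →L[ℝ] L2Vel :=
  (ContinuousLinearMap.mul ℝ ℝ).holderL velMeasure ∞ 2 2 hw.toLp

lemma coeFn_mulVel (w : ℝ → ℝ) (hw : MemLp w ∞ velMeasure) (φ : L2Vel) :
    mulVel w hw φ =ᵐ[velMeasure] fun v => w v * φ v := by
  filter_upwards [(ContinuousLinearMap.mul ℝ ℝ).coeFn_holder (r := 2) hw.toLp φ,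
    hw.coeFn_toLp] with v h1 h2
  rw [← h2]
  exact h1

lemma memLp_posPart : MemLp (fun v : ℝ => max v 0) ∞ velMeasure :=
  memLp_top_of_bound (by fun_prop) 1 <| ae_mem_Icc_velMeasure.mono fun v hv => by
    rw [Real.norm_of_nonneg (le_max_right _ _)]; exact max_le hv.2 zero_le_one

lemma memLp_negPart : MemLp (fun v : ℝ => min v 0) ∞ velMeasure :=
  memLp_top_of_bound (by fun_prop) 1 <| ae_mem_Icc_velMeasure.mono fun v hv => by
    rw [Real.norm_of_nonpos (min_le_right _ _)]
    exact neg_le.1 (le_min hv.1 (by norm_num))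

/-- The upwind difference as an element of `L²([-1, 1])`. -/
def upwindVel {M : ℕ} (g : ZMod M → L2Vel) (i : ZMod M) : L2Vel :=
  mulVel _ memLp_posPart (g i - g (i - 1)) + mulVel _ memLp_negPart (g (i + 1) - g i)

lemma coeFn_upwindVel {M : ℕ} (g : ZMod M → L2Vel) (i : ZMod M) :
    upwindVel g i =ᵐ[velMeasure] upwind g i := by
  filter_upwards [Lp.coeFn_add (mulVel _ memLp_posPart (g i - g (i - 1)))
      (mulVel _ memLp_negPart (g (i + 1) - g i)), coeFn_mulVel _ memLp_posPart (g i - g (i - 1)),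
    coeFn_mulVel _ memLp_negPart (g (i + 1) - g i), Lp.coeFn_sub (g i) (g (i - 1)),
    Lp.coeFn_sub (g (i + 1)) (g i)] with v h1 h2 h3 h4 h5
  rw [upwindVel, h1, Pi.add_apply, h2, h3, h4, h5]
  rfl

namespace IsCollisionKernel

variable {s : ℝ → ℝ → ℝ} {s_m s_M : ℝ}

lemma collision_congr {φ ψ : ℝ → ℝ} (h : φ =ᵐ[velMeasure] ψ) (v : ℝ) (hv : φ v = ψ v) :
    collision s φ v = collision s ψ v := by
  refine integral_congr_ae ?_
  filter_upwards [h] with v' hv'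
  rw [hv', hv]

/-- The collision operator as a linear map on `L²([-1, 1])`. -/
def collisionLM (hs : IsCollisionKernel s s_m s_M) : L2Vel →ₗ[ℝ] L2Vel where
  toFun φ := (hs.memLp_collision (L2Vel.memLp φ)).toLp
  map_add' φ ψ := by
    rw [← MemLp.toLp_add, MemLp.toLp_eq_toLp_iff]
    have hi : ∀ φ : L2Vel, Integrable φ velMeasure := fun φ =>
      (L2Vel.memLp φ).integrable one_le_two
    filter_upwards [ae_mem_Icc_velMeasure, Lp.coeFn_add φ ψ] with v hv h
    rw [collision_congr (Lp.coeFn_add φ ψ) v h, Pi.add_apply,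
      hs.collision_eq ((hi φ).add (hi ψ)) hv, hs.collision_eq (hi φ) hv,
      hs.collision_eq (hi ψ) hv]
    simp only [Pi.add_apply, mul_add]
    rw [integral_add (hs.integrable_mul (hi φ) hv) (hs.integrable_mul (hi ψ) hv)]
    ring
  map_smul' c φ := by
    rw [RingHom.id_apply, ← MemLp.toLp_const_smul, MemLp.toLp_eq_toLp_iff]
    filter_upwards [Lp.coeFn_smul c φ] with v h
    rw [collision_congr (Lp.coeFn_smul c φ) v h, Pi.smul_apply, smul_eq_mul]
    unfold collision
    rw [← integral_const_mul]
    congr 1; ext v'; simp; ring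

lemma coeFn_collisionLM (hs : IsCollisionKernel s s_m s_M) (φ : L2Vel) :
    hs.collisionLM φ =ᵐ[velMeasure] collision s φ :=
  MemLp.coeFn_toLp (hs.memLp_collision (L2Vel.memLp φ))

lemma inner_collisionLM (hs : IsCollisionKernel s s_m s_M) (φ ψ : L2Vel) :
    inner ℝ ψ (hs.collisionLM φ) = ∫ v, ψ v * collision s φ v ∂velMeasure := by
  rw [inner_L2Vel]
  refine integral_congr_ae ?_
  filter_upwards [hs.coeFn_collisionLM φ] with v hv
  rw [hv]

lemma collisionLM_isSymmetric (hs : IsCollisionKernel s s_m s_M) :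
    hs.collisionLM.IsSymmetric := by
  intro φ ψ
  have h1 := hs.two_mul_integral_mul_collision (L2Vel.memLp φ) (L2Vel.memLp ψ)
  have h2 := hs.two_mul_integral_mul_collision (L2Vel.memLp ψ) (L2Vel.memLp φ)
  rw [real_inner_comm, inner_collisionLM, inner_collisionLM]
  simp only [mul_comm (φ _ - φ _)] at h1
  linarith

/-- The collision operator as a bounded operator on `L²([-1, 1])`: it is everywhere defined and
symmetric, hence continuous. -/
def collisionCLM (hs : IsCollisionKernel s s_m s_M) : L2Vel →L[ℝ] L2Vel :=
  ⟨hs.collisionLM, hs.collisionLM_isSymmetric.continuous⟩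

lemma collisionCLM_apply (hs : IsCollisionKernel s s_m s_M) (φ : L2Vel) :
    hs.collisionCLM φ = hs.collisionLM φ := rfl

/-- For `c ≥ 0` the operator `1 - c 𝓛` is invertible: `𝓛` is dissipative, so that the
Lax-Milgram theorem applies. -/
lemma exists_equiv_one_sub (hs : IsCollisionKernel s s_m s_M) {c : ℝ} (hc : 0 ≤ c) :
    ∃ R : L2Vel ≃L[ℝ] L2Vel, ∀ φ, R φ = φ - c • hs.collisionCLM φ := by
  let B : L2Vel →L[ℝ] L2Vel →L[ℝ] ℝ :=
    (innerSL ℝ).comp (ContinuousLinearMap.id ℝ L2Vel - c • hs.collisionCLM)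
  have hB : ∀ φ ψ, B φ ψ = inner ℝ (φ - c • hs.collisionCLM φ) ψ := fun φ ψ => rfl
  have hco : IsCoercive B := by
    refine ⟨1, one_pos, fun φ => ?_⟩
    rw [hB, inner_sub_left, real_inner_smul_left, real_inner_comm, real_inner_self_eq_norm_mul_norm,
      real_inner_comm, collisionCLM_apply, inner_collisionLM]
    nlinarith [mul_nonpos_of_nonneg_of_nonpos hc
      (hs.integral_mul_collision_nonpos (L2Vel.memLp φ))]
  refine ⟨hco.continuousLinearEquivOfBilin, fun φ => ?_⟩
  refine ext_inner_right ℝ fun ψ => ?_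
  rw [hco.continuousLinearEquivOfBilin_apply, hB]

end IsCollisionKernel

section Explicit

variable {M : ℕ} {s : ℝ → ℝ → ℝ} {s_m s_M : ℝ} {σ : Torus → ℝ} {q : ℕ → Torus → ℝ} {ε Δt : ℝ}

/-- The explicit part of the microscopic equation, with noise factor `η`. -/
def explicitPart (ε Δt : ℝ) (ρ : ZMod M → ℝ) (g : ZMod M → L2Vel) (η : ℝ) (i : ZMod M) : L2Vel :=
  g i - (Δt / (ε * meshSize M)) • (upwindVel g i - velAvg (upwind g i) • oneVel) + η • g i
    - (1 / ε ^ 2 * ((ρ (i + 1) - ρ i) / meshSize M) * Δt) • idVel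

lemma coeFn_explicitPart (ρ : ZMod M → ℝ) (g : ZMod M → L2Vel) (η : ℝ) (i : ZMod M) :
    explicitPart ε Δt ρ g η i =ᵐ[velMeasure] fun v => g i v
      - Δt / (ε * meshSize M) * (upwind g i v - velAvg (upwind g i)) + g i v * η
      - 1 / ε ^ 2 * v * ((ρ (i + 1) - ρ i) / meshSize M) * Δt := by
  set a := Δt / (ε * meshSize M)
  set b := 1 / ε ^ 2 * ((ρ (i + 1) - ρ i) / meshSize M) * Δt with hb
  set m := velAvg (upwind g i) with hm
  filter_upwards [Lp.coeFn_sub (g i - a • (upwindVel g i - m • oneVel) + η • g i) (b • idVel),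
    Lp.coeFn_add (g i - a • (upwindVel g i - m • oneVel)) (η • g i),
    Lp.coeFn_sub (g i) (a • (upwindVel g i - m • oneVel)),
    Lp.coeFn_smul a (upwindVel g i - m • oneVel), Lp.coeFn_sub (upwindVel g i) (m • oneVel),
    Lp.coeFn_smul m oneVel, Lp.coeFn_smul η (g i), Lp.coeFn_smul b idVel, coeFn_upwindVel g i,
    coeFn_oneVel, coeFn_idVel] with v h1 h2 h3 h4 h5 h6 h7 h8 h9 h10 h11
  rw [explicitPart, ← hm, h1, Pi.sub_apply, h2, Pi.add_apply, h3, Pi.sub_apply, h4, Pi.smul_apply,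
    h5, Pi.sub_apply, h6, Pi.smul_apply, h7, Pi.smul_apply, h8, Pi.smul_apply, h9, h10, h11]
  simp only [smul_eq_mul, hb]
  ring

/-- The implicit equation for `g'` has the form `(1 - c 𝓛) g' = explicitPart`. -/
lemma SchemeStep.sub_collision_eq {ξ : ℕ → ℝ} {ρ ρ' : ZMod M → ℝ} {g g' : ZMod M → L2Vel}
    (h : SchemeStep s σ q ε Δt ξ ρ g ρ' g') (hs : IsCollisionKernel s s_m s_M) (i : ZMod M) :
    g' i - (σ (halfNode M i) / ε ^ 2 * Δt) • hs.collisionCLM (g' i)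
      = explicitPart ε Δt ρ g (noiseFactor Δt (fun k => q k (halfNode M i)) ξ) i := by
  refine Lp.ext ?_
  filter_upwards [Lp.coeFn_sub (g' i) ((σ (halfNode M i) / ε ^ 2 * Δt) • hs.collisionCLM (g' i)),
    Lp.coeFn_smul (σ (halfNode M i) / ε ^ 2 * Δt) (hs.collisionCLM (g' i)),
    hs.coeFn_collisionLM (g' i), coeFn_explicitPart ρ g
      (noiseFactor Δt (fun k => q k (halfNode M i)) ξ) i, h.2 i] with v h1 h2 h3 h4 h5
  rw [h1, h4, Pi.sub_apply, h2, Pi.smul_apply, hs.collisionCLM_apply, h3, smul_eq_mul, h5]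
  ring

lemma stronglyMeasurable_explicitPart {Ω : Type*} {m : MeasurableSpace Ω} {ρ : ZMod M → Ω → ℝ}
    {g : ZMod M → Ω → L2Vel} {η : Ω → ℝ} (hρ : ∀ i, StronglyMeasurable[m] (ρ i))
    (hg : ∀ i, StronglyMeasurable[m] (g i)) (hη : StronglyMeasurable[m] η) (i : ZMod M) :
    StronglyMeasurable[m]
      fun ω => explicitPart ε Δt (fun j => ρ j ω) (fun j => g j ω) (η ω) i := by
  have hup : StronglyMeasurable[m] fun ω => upwindVel (fun j => g j ω) i :=
    ((ContinuousLinearMap.continuous _).comp_stronglyMeasurable ((hg i).sub (hg (i - 1)))).add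
      ((ContinuousLinearMap.continuous _).comp_stronglyMeasurable ((hg (i + 1)).sub (hg i)))
  have havg : StronglyMeasurable[m] fun ω => velAvg (upwind (fun j => g j ω) i) := by
    have e : ∀ ω, velAvg (upwind (fun j => g j ω) i)
        = 1 / 2 * inner ℝ oneVel (upwindVel (fun j => g j ω) i) := fun ω => by
      rw [velAvg, ← integral_eq_inner_oneVel, integral_congr_ae (coeFn_upwindVel _ i)]
    simp only [e]
    exact ((innerSL ℝ oneVel).continuous.comp_stronglyMeasurable hup).const_mul _
  have hd : StronglyMeasurable[m]
      fun ω => 1 / ε ^ 2 * ((ρ (i + 1) ω - ρ i ω) / meshSize M) * Δt :=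
    (((((hρ (i + 1)).sub (hρ i)).measurable.div_const _).const_mul _).mul_const _).stronglyMeasurable
  have h1 : StronglyMeasurable[m] fun ω => (Δt / (ε * meshSize M)) •
      (upwindVel (fun j => g j ω) i - velAvg (upwind (fun j => g j ω) i) • oneVel) :=
    (hup.sub (havg.smul_const oneVel)).const_smul (Δt / (ε * meshSize M))
  have h2 : StronglyMeasurable[m] fun ω => η ω • g i ω := hη.smul (hg i)
  exact (((hg i).sub h1).add h2).sub (hd.smul_const idVel)

/-- The flux which enters the macroscopic equation depends continuously on the profiles. -/
lemma velAvg_flux (φ ψ : L2Vel) (d : ℝ) :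
    velAvg (fun v => v * ((φ v - ψ v) / d)) = 1 / 2 * (inner ℝ idVel (φ - ψ) / d) := by
  rw [velAvg, inner_L2Vel, ← integral_div]
  congr 1
  refine integral_congr_ae ?_
  filter_upwards [Lp.coeFn_sub φ ψ, coeFn_idVel] with v h1 h2
  rw [h1, h2, Pi.sub_apply, mul_div_assoc]

/-- The unknowns after one step are determined by the unknowns before the step and the noise
factors, and depend measurably on them. -/
lemma exists_stronglyMeasurable_step {Ω : Type*} {m : MeasurableSpace Ω}
    (hs : IsCollisionKernel s s_m s_M) (hσ : ∀ x, 0 ≤ σ x) (hΔt : 0 ≤ Δt)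
    {ξ : ℕ → Ω → ℝ} {ρ : ZMod M → Ω → ℝ} {g : ZMod M → Ω → L2Vel}
    {η₁ η₂ : ZMod M → Ω → ℝ} (hρ : ∀ i, StronglyMeasurable[m] (ρ i))
    (hg : ∀ i, StronglyMeasurable[m] (g i)) (hη₁ : ∀ i, StronglyMeasurable[m] (η₁ i))
    (hη₂ : ∀ i, StronglyMeasurable[m] (η₂ i)) :
    ∃ (ρ' : ZMod M → Ω → ℝ) (g' : ZMod M → Ω → L2Vel),
      (∀ i, StronglyMeasurable[m] (ρ' i)) ∧ (∀ i, StronglyMeasurable[m] (g' i)) ∧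
      ∀ (ω : Ω) (ρ'' : ZMod M → ℝ) (g'' : ZMod M → L2Vel),
        SchemeStep s σ q ε Δt (fun k => ξ k ω) (fun i => ρ i ω) (fun i => g i ω) ρ'' g'' →
        (∀ i, noiseFactor Δt (fun k => q k (node M i)) (fun k => ξ k ω) = η₁ i ω) →
        (∀ i, noiseFactor Δt (fun k => q k (halfNode M i)) (fun k => ξ k ω) = η₂ i ω) →
        (∀ i, ρ'' i = ρ' i ω) ∧ ∀ i, g'' i = g' i ω := by
  have hc : ∀ i, 0 ≤ σ (halfNode M i) / ε ^ 2 * Δt := fun i =>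
    mul_nonneg (div_nonneg (hσ _) (sq_nonneg _)) hΔt
  choose R hR using fun i => hs.exists_equiv_one_sub (hc i)
  let G : ZMod M → Ω → L2Vel := fun i ω =>
    (R i).symm (explicitPart ε Δt (fun j => ρ j ω) (fun j => g j ω) (η₂ i ω) i)
  have hG : ∀ i, StronglyMeasurable[m] (G i) := fun i =>
    (R i).symm.continuous.comp_stronglyMeasurable
      (stronglyMeasurable_explicitPart hρ hg (hη₂ i) i)
  refine ⟨fun i ω => ρ i ω
      - Δt * (1 / 2 * (inner ℝ idVel (G i ω - G (i - 1) ω) / meshSize M)) + ρ i ω * η₁ i ω, G,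
    fun i => ?_, hG, fun ω ρ'' g'' h e₁ e₂ => ?_⟩
  · have h1 : StronglyMeasurable[m] fun ω => inner ℝ idVel (G i ω - G (i - 1) ω) :=
      (innerSL ℝ idVel).continuous.comp_stronglyMeasurable ((hG i).sub (hG (i - 1)))
    have h2 : StronglyMeasurable[m] fun ω =>
        Δt * (1 / 2 * (inner ℝ idVel (G i ω - G (i - 1) ω) / meshSize M)) :=
      (((h1.measurable.div_const _).const_mul _).const_mul _).stronglyMeasurable
    exact ((hρ i).sub h2).add ((hρ i).mul (hη₁ i))
  · have hgeq : ∀ i, g'' i = G i ω := fun i => by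
      rw [ContinuousLinearEquiv.eq_symm_apply, hR, h.sub_collision_eq hs, e₂]
    refine ⟨fun i => ?_, hgeq⟩
    rw [h.1 i, e₁, velAvg_flux, hgeq, hgeq]

end Explicit

/-! ### Gaussian series -/

section Series

variable {Ω : Type*} [mΩ : MeasurableSpace Ω] {P : Measure Ω} {X : ℕ → Ω → ℝ}

lemma lintegral_sq_le_of_tendsto {Y : ℕ → Ω → ℝ} {Z : Ω → ℝ} {c : ℝ≥0∞}
    (hY : ∀ n, Measurable (Y n)) (hlim : ∀ᵐ ω ∂P, Tendsto (fun n => Y n ω) atTop (𝓝 (Z ω)))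
    (hc : ∀ᶠ n in atTop, ∫⁻ ω, ENNReal.ofReal (Y n ω ^ 2) ∂P ≤ c) :
    ∫⁻ ω, ENNReal.ofReal (Z ω ^ 2) ∂P ≤ c := by
  calc ∫⁻ ω, ENNReal.ofReal (Z ω ^ 2) ∂P
      = ∫⁻ ω, liminf (fun n => ENNReal.ofReal (Y n ω ^ 2)) atTop ∂P := by
        refine lintegral_congr_ae ?_
        filter_upwards [hlim] with ω hω
        exact ((ENNReal.continuous_ofReal.tendsto _).comp (hω.pow 2)).liminf_eq.symm
    _ ≤ liminf (fun n => ∫⁻ ω, ENNReal.ofReal (Y n ω ^ 2) ∂P) atTop :=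
        lintegral_liminf_le fun n => ((hY n).pow_const 2).ennreal_ofReal
    _ ≤ c := liminf_le_of_le (by isBoundedDefault) fun d hd => by
        obtain ⟨n, h1, h2⟩ := (hd.and hc).exists
        exact h1.trans h2

variable [IsProbabilityMeasure P]

/-- The second moment of a finite sum of independent standard variables. -/
lemma lintegral_sq_sum_mul (hL2 : ∀ k, MemLp (X k) 2 P) (hmean : ∀ k, ∫ ω, X k ω ∂P = 0)
    (hvar : ∀ k, Var[X k; P] = 1) (hind : iIndepFun X P) (b : ℕ → ℝ) (s : Finset ℕ) :
    ∫⁻ ω, ENNReal.ofReal ((∑ k ∈ s, b k * X k ω) ^ 2) ∂P = ENNReal.ofReal (∑ k ∈ s, b k ^ 2) := by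
  have hm : ∀ k ∈ s, MemLp (fun ω => b k * X k ω) 2 P := fun k _ => (hL2 k).const_mul _
  have hI : MemLp (fun ω => ∑ k ∈ s, b k * X k ω) 2 P := memLp_finsetSum s hm
  rw [← ofReal_integral_eq_lintegral_ofReal hI.integrable_sq
    (Eventually.of_forall fun _ => sq_nonneg _)]
  congr 1
  have h0 : ∫ ω, ∑ k ∈ s, b k * X k ω ∂P = 0 := by
    rw [integral_finsetSum _ fun k hk => (hm k hk).integrable one_le_two]
    exact Finset.sum_eq_zero fun k _ => by rw [integral_const_mul, hmean, mul_zero]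
  rw [← variance_of_integral_eq_zero hI.1.aemeasurable h0]
  have hsum := IndepFun.variance_sum (s := s) (X := fun k ω => b k * X k ω) hm
    fun i _ j _ hij => (hind.indepFun hij).comp (measurable_const_mul (b i))
      (measurable_const_mul (b j))
  have e : (fun ω => ∑ k ∈ s, b k * X k ω) = ∑ k ∈ s, fun ω => b k * X k ω := by
    ext ω; simp
  rw [e, hsum]
  exact Finset.sum_congr rfl fun k _ => by rw [variance_const_mul, hvar, mul_one]

/-- Partial sums of a series of independent centred variables form a martingale; if they are
bounded in `L²`, they converge almost surely. -/
lemma exists_tendsto_sum_mul (hX : ∀ k, Measurable (X k)) (hL2 : ∀ k, MemLp (X k) 2 P)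
    (hmean : ∀ k, ∫ ω, X k ω ∂P = 0) (hvar : ∀ k, Var[X k; P] = 1) (hind : iIndepFun X P)
    {b : ℕ → ℝ} (hb : Summable fun k => b k ^ 2) :
    ∃ S : Ω → ℝ, StronglyMeasurable[⨆ k, MeasurableSpace.comap (X k) inferInstance] S ∧
      ∀ᵐ ω ∂P, Tendsto (fun K => ∑ k ∈ Finset.range K, b k * X k ω) atTop (𝓝 (S ω)) := by
  have hsm : ∀ k, StronglyMeasurable (X k) := fun k => (hX k).stronglyMeasurable
  let ℱ := Filtration.natural X hsm
  let Y : ℕ → Ω → ℝ := fun n ω => ∑ k ∈ Finset.range (n + 1), b k * X k ω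
  have hint : ∀ k, Integrable (X k) P := fun k => (hL2 k).integrable one_le_two
  have hXℱ : ∀ k n, k ≤ n → StronglyMeasurable[ℱ n] (X k) := fun k n hkn =>
    (Filtration.stronglyAdapted_natural hsm k).mono (ℱ.mono hkn)
  have hadp : StronglyAdapted ℱ Y := fun n =>
    Finset.stronglyMeasurable_fun_sum _ fun k hk =>
      (hXℱ k n (Nat.lt_succ_iff.1 (Finset.mem_range.1 hk))).const_mul (b k)
  have hmart : Martingale Y ℱ P := by
    refine martingale_of_condExp_sub_eq_zero_nat hadp
      (fun n => integrable_finsetSum _ fun k _ => (hint k).const_mul _) fun n => ?_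
    have e : Y (n + 1) - Y n = b (n + 1) • X (n + 1) := by
      ext ω
      simp only [Y, Pi.sub_apply, Pi.smul_apply, smul_eq_mul]
      rw [Finset.sum_range_succ _ (n + 1)]
      ring
    rw [e]
    filter_upwards [condExp_smul (μ := P) (b (n + 1)) (X (n + 1)) (ℱ n),
      hind.condExp_natural_ae_eq_of_lt hsm n.lt_succ_self] with ω h1 h2
    rw [h1, Pi.smul_apply, h2, hmean, smul_zero, Pi.zero_apply]
  have hbdd : ∀ n, eLpNorm (Y n) 1 P ≤ ((1 + Real.toNNReal (∑' k, b k ^ 2) : ℝ≥0) : ℝ≥0∞) := by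
    intro n
    rw [eLpNorm_one_eq_lintegral_enorm]
    calc ∫⁻ ω, ‖Y n ω‖ₑ ∂P ≤ ∫⁻ ω, (1 + ENNReal.ofReal (Y n ω ^ 2)) ∂P := by
          refine lintegral_mono fun ω => ?_
          rw [← ofReal_norm, ← ENNReal.ofReal_one,
            ← ENNReal.ofReal_add zero_le_one (sq_nonneg _)]
          refine ENNReal.ofReal_le_ofReal ?_
          rw [Real.norm_eq_abs, ← sq_abs]
          nlinarith [sq_nonneg (|Y n ω| - 1)]
      _ = 1 + ENNReal.ofReal (∑ k ∈ Finset.range (n + 1), b k ^ 2) := by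
          rw [lintegral_add_left measurable_const, lintegral_sq_sum_mul hL2 hmean hvar hind]
          simp
      _ ≤ _ := by
          push_cast
          gcongr
          exact ENNReal.ofReal_le_ofReal (hb.sum_le_tsum _ fun k _ => sq_nonneg _)
  refine ⟨_, Filtration.stronglyMeasurable_limitProcess.mono (iSup_le fun n => ?_),
    (hmart.submartingale.ae_tendsto_limitProcess hbdd).mono fun ω hω =>
      (tendsto_add_atTop_iff_nat 1).1 hω⟩
  exact iSup₂_le fun k _ => le_iSup_of_le k le_rfl

/-- The sum of a Gaussian series with square summable coefficients exists almost surely, is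
centred, and its second moment is at most the sum of the squared coefficients. -/
lemma exists_seriesSum (hX : ∀ k, Measurable (X k)) (hlaw : ∀ k, HasLaw (X k) (gaussianReal 0 1) P)
    (hind : iIndepFun X P) {b : ℕ → ℝ} (hb : Summable fun k => b k ^ 2) :
    ∃ S : Ω → ℝ, StronglyMeasurable[⨆ k, MeasurableSpace.comap (X k) inferInstance] S ∧
      (∀ᵐ ω ∂P, seriesSum b (fun k => X k ω) = S ω) ∧ MemLp S 2 P ∧ ∫ ω, S ω ∂P = 0 ∧
      ∫ ω, S ω ^ 2 ∂P ≤ ∑' k, b k ^ 2 := by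
  have hL2 : ∀ k, MemLp (X k) 2 P := fun k => by
    have := memLp_id_gaussianReal (μ := 0) (v := 1) 2
    rw [← (hlaw k).map_eq] at this
    simpa using this.comp_of_map (hlaw k).aemeasurable
  have hmean : ∀ k, ∫ ω, X k ω ∂P = 0 := fun k => by
    rw [(hlaw k).integral_eq]; simp
  have hvar : ∀ k, Var[X k; P] = 1 := fun k => by
    rw [(hlaw k).variance_eq, variance_id_gaussianReal]; simp
  obtain ⟨S, hS, hlim⟩ := exists_tendsto_sum_mul hX hL2 hmean hvar hind hb
  have hS' : AEStronglyMeasurable S P :=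
    (hS.mono (iSup_le fun k => (hX k).comap_le)).aestronglyMeasurable
  have hYmeas : ∀ s : Finset ℕ, Measurable fun ω => ∑ k ∈ s, b k * X k ω := fun s =>
    Finset.measurable_fun_sum s fun k _ => (hX k).const_mul (b k)
  -- Fatou's lemma for the remainders of the series
  have htail : ∀ K, ∫⁻ ω, ENNReal.ofReal ((S ω - ∑ k ∈ Finset.range K, b k * X k ω) ^ 2) ∂P
      ≤ ENNReal.ofReal (∑' k, b (k + K) ^ 2) := by
    intro K
    refine lintegral_sq_le_of_tendsto
      (Y := fun n ω => ∑ k ∈ Finset.Ico K n, b k * X k ω) (fun n => hYmeas _) ?_ ?_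
    · filter_upwards [hlim] with ω hω
      refine (hω.sub_const (∑ k ∈ Finset.range K, b k * X k ω)).congr' ?_
      filter_upwards [eventually_ge_atTop K] with n hn
      rw [Finset.sum_Ico_eq_sub _ hn]
    · filter_upwards with n
      rw [lintegral_sq_sum_mul hL2 hmean hvar hind]
      refine ENNReal.ofReal_le_ofReal ?_
      rw [Finset.sum_Ico_eq_sum_range]
      simp only [add_comm K]
      exact ((summable_nat_add_iff (f := fun k => b k ^ 2) K).2 hb).sum_le_tsum _
        fun k _ => sq_nonneg _
  have h0 := htail 0
  simp only [Finset.range_zero, Finset.sum_empty, sub_zero, add_zero] at h0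
  have hSL2 : MemLp S 2 P := by
    refine (memLp_two_iff_integrable_sq hS').2 ⟨hS'.pow 2, ?_⟩
    rw [hasFiniteIntegral_iff_ofReal (Eventually.of_forall fun ω => sq_nonneg _)]
    exact h0.trans_lt ENNReal.ofReal_lt_top
  have htail' : ∀ K, ∫ ω, (S ω - ∑ k ∈ Finset.range K, b k * X k ω) ^ 2 ∂P
      ≤ ∑' k, b (k + K) ^ 2 := by
    intro K
    have hm : MemLp (fun ω => S ω - ∑ k ∈ Finset.range K, b k * X k ω) 2 P :=
      hSL2.sub (memLp_finsetSum _ fun k _ => (hL2 k).const_mul _)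
    have := htail K
    rw [← ofReal_integral_eq_lintegral_ofReal hm.integrable_sq
      (Eventually.of_forall fun _ => sq_nonneg _)] at this
    exact (ENNReal.ofReal_le_ofReal_iff (tsum_nonneg fun k => sq_nonneg _)).1 this
  refine ⟨S, hS, ?_, hSL2, ?_, by simpa using htail' 0⟩
  · filter_upwards [hlim] with ω hω
    exact hω.limUnder_eq
  · have hle : ∀ K, (∫ ω, S ω ∂P) ^ 2 ≤ ∑' k, b (k + K) ^ 2 := by
      intro K
      have hsum : MemLp (fun ω => ∑ k ∈ Finset.range K, b k * X k ω) 2 P :=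
        memLp_finsetSum _ fun k _ => (hL2 k).const_mul _
      have hm : MemLp (fun ω => S ω - ∑ k ∈ Finset.range K, b k * X k ω) 2 P := hSL2.sub hsum
      have e : ∫ ω, S ω ∂P = ∫ ω, (S ω - ∑ k ∈ Finset.range K, b k * X k ω) ∂P := by
        rw [integral_sub (hSL2.integrable one_le_two) (hsum.integrable one_le_two),
          integral_finsetSum _ fun k _ => ((hL2 k).const_mul _).integrable one_le_two]
        simp [integral_const_mul, hmean]
      have hv := variance_nonneg (fun ω => S ω - ∑ k ∈ Finset.range K, b k * X k ω) P
      rw [variance_eq_sub hm] at hv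
      rw [e]
      have := htail' K
      simp only [Pi.pow_apply] at hv
      linarith
    have hlim0 := tendsto_sum_nat_add fun k => b k ^ 2
    have := ge_of_tendsto' hlim0 hle
    exact pow_eq_zero_iff two_ne_zero |>.1 (le_antisymm this (sq_nonneg _))

end Series

/-! ### The noise factor and its independence of the past -/

/-- The coefficients `q k x` are square summable, uniformly in the point `x`. -/
lemma IsNoiseCoefficient.exists_bound {e : HilbertBasis ℕ ℝ L2Torus} {Q : L2Torus →L[ℝ] L2Torus}
    {q : ℕ → Torus → ℝ} (hQ : IsNoiseCoefficient e Q q) :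
    ∃ Γ : ℝ, 0 ≤ Γ ∧ ∀ x, (Summable fun k => q k x ^ 2) ∧ ∑' k, q k x ^ 2 ≤ Γ := by
  refine ⟨_, ENNReal.toReal_nonneg (a := ∑' k, eLpNorm (Q (e k)) ∞ volume ^ 2), fun x => ?_⟩
  have e1 : ∀ k, q k x ^ 2 = (‖q k x‖ₑ ^ 2).toReal := fun k => by
    rw [ENNReal.toReal_pow, toReal_enorm, Real.norm_eq_abs, sq_abs]
  have hle : ∑' k, ‖q k x‖ₑ ^ 2 ≤ ∑' k, eLpNorm (Q (e k)) ∞ volume ^ 2 :=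
    ENNReal.tsum_le_tsum fun k => pow_le_pow_left₀ zero_le (hQ.bound k x) 2
  have hfin : ∑' k, ‖q k x‖ₑ ^ 2 ≠ ∞ := (hle.trans_lt hQ.trace).ne
  simp only [e1]
  refine ⟨ENNReal.summable_toReal hfin, ?_⟩
  rw [← ENNReal.tsum_toReal_eq fun k => ENNReal.pow_ne_top enorm_ne_top]
  exact ENNReal.toReal_mono hQ.trace.ne hle

section Probability

variable {Ω : Type*} {m₀ F N : MeasurableSpace Ω} {ξ : ℕ → ℕ → Ω → ℝ}

/-- The information contained in the `(n + 1)`-st family of normal variables. -/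
abbrev stepNoise (ξ : ℕ → ℕ → Ω → ℝ) (n : ℕ) : MeasurableSpace Ω :=
  ⨆ k, MeasurableSpace.comap (ξ (n + 1) k) inferInstance

/-- The information available after `n` steps: the initial data, described by `m₀`, and the first
`n` families of normal variables. -/
abbrev history (m₀ : MeasurableSpace Ω) (ξ : ℕ → ℕ → Ω → ℝ) (n : ℕ) : MeasurableSpace Ω :=
  m₀ ⊔ ⨆ p ∈ {p : ℕ × ℕ | p.1 < n}, MeasurableSpace.comap (ξ (p.1 + 1) p.2) inferInstance

lemma stepNoise_le_history (n : ℕ) : stepNoise ξ n ≤ history m₀ ξ (n + 1) :=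
  le_sup_of_le_right <| iSup_le fun k =>
    le_iSup₂_of_le (n, k) (show (n, k).1 < n + 1 from n.lt_succ_self) le_rfl

lemma history_le_succ (n : ℕ) : history m₀ ξ n ≤ history m₀ ξ (n + 1) :=
  sup_le_sup_left (biSup_mono fun _ hp => Nat.lt_succ_of_lt hp) _

variable {mΩ : MeasurableSpace Ω} {P : Measure Ω}

lemma energy_eq_lintegral {M : ℕ} [NeZero M] {ε : ℝ} {ρ : ZMod M → Ω → ℝ} {g : ZMod M → Ω → L2Vel}
    (hρ : ∀ i, AEMeasurable (ρ i) P) :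
    energy P ε ρ g = ∫⁻ ω, ENNReal.ofReal
      (∑ i, ρ i ω ^ 2 + ε ^ 2 * ∑ i, velAvg (fun v => g i ω v ^ 2)) ∂P := by
  have hm : AEMeasurable (fun ω => ENNReal.ofReal (∑ i, ρ i ω ^ 2)) P :=
    (Finset.aemeasurable_fun_sum _ fun i _ => (hρ i).pow_const 2).ennreal_ofReal
  rw [energy, ← lintegral_const_mul' _ _ ENNReal.ofReal_ne_top, ← lintegral_add_left' hm]
  congr 1; ext ω
  have h0 : 0 ≤ ∑ i, velAvg (fun v => g i ω v ^ 2) :=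
    Finset.sum_nonneg fun i _ => by rw [velAvg_sq]; positivity
  rw [← ENNReal.ofReal_mul (sq_nonneg ε), ← ENNReal.ofReal_add
    (Finset.sum_nonneg fun i _ => sq_nonneg _) (mul_nonneg (sq_nonneg ε) h0)]

/-- Nonnegative weights which are independent of the past and have expectation at most `c`
increase the expectation of a sum by a factor of at most `c`. -/
lemma lintegral_sum_mul_le {ι : Type*} [Fintype ι] (hF : F ≤ mΩ)
    (hN : N ≤ mΩ) (hind : Indep F N P) {A G : ι → Ω → ℝ} (hA : ∀ i, StronglyMeasurable[F] (A i))
    (hG : ∀ i, StronglyMeasurable[N] (G i)) (hA0 : ∀ i ω, 0 ≤ A i ω) (hG0 : ∀ i ω, 0 ≤ G i ω)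
    {c : ℝ≥0∞} (hc : ∀ i, ∫⁻ ω, ENNReal.ofReal (G i ω) ∂P ≤ c) :
    ∫⁻ ω, ENNReal.ofReal (∑ i, G i ω * A i ω) ∂P
      ≤ c * ∫⁻ ω, ENNReal.ofReal (∑ i, A i ω) ∂P := by
  have hA' : ∀ i, Measurable[F] fun ω => ENNReal.ofReal (A i ω) := fun i =>
    (hA i).measurable.ennreal_ofReal
  have hG' : ∀ i, Measurable[N] fun ω => ENNReal.ofReal (G i ω) := fun i =>
    (hG i).measurable.ennreal_ofReal
  have hAm : ∀ i, Measurable fun ω => ENNReal.ofReal (A i ω) := fun i => (hA' i).mono hF le_rfl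
  have hGm : ∀ i, Measurable fun ω => ENNReal.ofReal (G i ω) := fun i => (hG' i).mono hN le_rfl
  have e1 : ∀ ω, ENNReal.ofReal (∑ i, G i ω * A i ω)
      = ∑ i, ENNReal.ofReal (G i ω) * ENNReal.ofReal (A i ω) := fun ω => by
    rw [ENNReal.ofReal_sum_of_nonneg fun i _ => mul_nonneg (hG0 i ω) (hA0 i ω)]
    exact Finset.sum_congr rfl fun i _ => ENNReal.ofReal_mul (hG0 i ω)
  have e2 : ∀ ω, ENNReal.ofReal (∑ i, A i ω) = ∑ i, ENNReal.ofReal (A i ω) := fun ω =>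
    ENNReal.ofReal_sum_of_nonneg fun i _ => hA0 i ω
  simp only [e1, e2]
  have hGA : ∀ i, Measurable fun ω => ENNReal.ofReal (G i ω) * ENNReal.ofReal (A i ω) :=
    fun i => (hGm i).mul (hAm i)
  rw [lintegral_finsetSum _ fun i _ => hGA i, lintegral_finsetSum _ fun i _ => hAm i,
    Finset.mul_sum]
  refine Finset.sum_le_sum fun i _ => ?_
  rw [lintegral_mul_eq_lintegral_mul_lintegral_of_independent_measurableSpace hN hF hind.symm
    (hG' i) (hA' i)]
  gcongr
  exact hc i

variable [IsProbabilityMeasure P]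

/-- The mean of the growth factor is `1 + O(Δt)`: the terms of order `√Δt` are centred. -/
lemma lintegral_growth_le {S : Ω → ℝ} {B Γ Δt : ℝ} (hΔt : 0 ≤ Δt) (hS : MemLp S 2 P)
    (h0 : ∫ ω, S ω ∂P = 0) (h2 : ∫ ω, S ω ^ 2 ∂P ≤ B) (hB0 : 0 ≤ B) (hB : B ≤ Γ) :
    ∫⁻ ω, ENNReal.ofReal (growth (1 / 2 * Δt * B + √Δt * S ω)) ∂P
      ≤ ENNReal.ofReal (Real.exp (5 * Γ * Δt)) := by
  have e : ∀ ω, growth (1 / 2 * Δt * B + √Δt * S ω) = (1 + Δt * B + (Δt * B) ^ 2)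
      + (2 * √Δt + 4 * Δt * B * √Δt) * S ω + 4 * Δt * S ω ^ 2 := fun ω => by
    unfold growth
    linear_combination (4 * S ω ^ 2) * Real.sq_sqrt hΔt
  have i1 : Integrable (fun ω => (1 + Δt * B + (Δt * B) ^ 2)
      + (2 * √Δt + 4 * Δt * B * √Δt) * S ω) P :=
    (integrable_const _).add ((hS.integrable one_le_two).const_mul _)
  have i2 : Integrable (fun ω => 4 * Δt * S ω ^ 2) P := hS.integrable_sq.const_mul _
  have hint : Integrable (fun ω => growth (1 / 2 * Δt * B + √Δt * S ω)) P := by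
    simp only [e]; exact i1.add i2
  rw [← ofReal_integral_eq_lintegral_ofReal hint (Eventually.of_forall fun _ => growth_nonneg _)]
  refine ENNReal.ofReal_le_ofReal ?_
  simp only [e]
  rw [integral_add i1 i2,
    integral_add (integrable_const _) ((hS.integrable one_le_two).const_mul _),
    integral_const_mul, integral_const_mul, h0]
  simp only [integral_const, probReal_univ, one_smul, mul_zero, add_zero]
  have hx : Δt * B ≤ Δt * Γ := mul_le_mul_of_nonneg_left hB hΔt
  have hx0 : 0 ≤ Δt * B := mul_nonneg hΔt hB0
  have hy : 0 ≤ 5 * Γ * Δt := by nlinarith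
  have := Real.quadratic_le_exp_of_nonneg hy
  nlinarith [mul_le_mul_of_nonneg_left h2 hΔt]

/-- If `m₀` is independent of `F ⊔ N` and `F` of `N`, then `m₀ ⊔ F` is independent of `N`. -/
lemma indep_sup_left_of_indep (hm₀ : m₀ ≤ mΩ) (hF : F ≤ mΩ) (hN : N ≤ mΩ)
    (h : Indep m₀ (F ⊔ N) P) (hFN : Indep F N P) : Indep (m₀ ⊔ F) N P := by
  let π : Set (Set Ω) := {t | ∃ u v, MeasurableSet[m₀] u ∧ MeasurableSet[F] v ∧ t = u ∩ v}
  have hπ : IsPiSystem π := by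
    rintro _ ⟨u, v, hu, hv, rfl⟩ _ ⟨u', v', hu', hv', rfl⟩ -
    exact ⟨u ∩ u', v ∩ v', hu.inter hu', hv.inter hv', inter_inter_inter_comm u v u' v'⟩
  have hgen : m₀ ⊔ F = MeasurableSpace.generateFrom π := by
    refine le_antisymm (sup_le (fun u hu => ?_) fun v hv => ?_)
      (MeasurableSpace.generateFrom_le ?_)
    · exact MeasurableSpace.measurableSet_generateFrom
        ⟨u, univ, hu, MeasurableSet.univ, (inter_univ u).symm⟩
    · exact MeasurableSpace.measurableSet_generateFrom
        ⟨univ, v, MeasurableSet.univ, hv, (univ_inter v).symm⟩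
    · rintro _ ⟨u, v, hu, hv, rfl⟩
      exact MeasurableSet.inter ((le_sup_left : m₀ ≤ m₀ ⊔ F) u hu)
        ((le_sup_right : F ≤ m₀ ⊔ F) v hv)
  refine IndepSets.indep (sup_le hm₀ hF) hN hπ
    (@MeasurableSpace.isPiSystem_measurableSet Ω N) hgen
    (@MeasurableSpace.generateFrom_measurableSet Ω N).symm ?_
  rw [IndepSets_iff]
  rintro _ w ⟨u, v, hu, hv, rfl⟩ hw
  rw [Indep_iff] at h hFN
  have hvFN := (le_sup_left : F ≤ F ⊔ N) v hv
  have hwFN := (le_sup_right : N ≤ F ⊔ N) w hw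
  rw [inter_assoc, h u (v ∩ w) hu (MeasurableSet.inter hvFN hwFN), hFN v w hv hw, h u v hu hvFN,
    mul_assoc]

lemma indep_history_stepNoise (hξ : ∀ n k, Measurable (ξ (n + 1) k))
    (hind : iIndepFun (fun p : ℕ × ℕ => ξ (p.1 + 1) p.2) P) (hm₀ : m₀ ≤ mΩ)
    (h : Indep m₀ (⨆ p : ℕ × ℕ, MeasurableSpace.comap (ξ (p.1 + 1) p.2) inferInstance) P)
    (n : ℕ) : Indep (history m₀ ξ n) (stepNoise ξ n) P := by
  have hle : ∀ p : ℕ × ℕ, MeasurableSpace.comap (ξ (p.1 + 1) p.2) inferInstance ≤ mΩ :=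
    fun p => (hξ p.1 p.2).comap_le
  have hstep : stepNoise ξ n
      = ⨆ p ∈ {p : ℕ × ℕ | p.1 = n}, MeasurableSpace.comap (ξ (p.1 + 1) p.2) inferInstance := by
    refine le_antisymm (iSup_le fun k => le_iSup₂_of_le (n, k) rfl le_rfl) (iSup₂_le ?_)
    rintro ⟨_, k⟩ rfl
    exact le_iSup_of_le k le_rfl
  rw [hstep]
  refine indep_sup_left_of_indep hm₀ (iSup₂_le fun p _ => hle p) (iSup₂_le fun p _ => hle p)
    (indep_of_indep_of_le_right h (sup_le (iSup₂_le fun p _ => ?_) (iSup₂_le fun p _ => ?_)))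
    (indep_iSup_of_disjoint hle hind.iIndep ?_)
  · exact le_iSup_of_le p le_rfl
  · exact le_iSup_of_le p le_rfl
  · exact Set.disjoint_left.2 fun p hp hp' => (ne_of_lt hp) hp'

lemma history_le (hξ : ∀ n k, Measurable (ξ (n + 1) k)) (hm₀ : m₀ ≤ mΩ) (n : ℕ) :
    history m₀ ξ n ≤ mΩ :=
  sup_le hm₀ (iSup₂_le fun p _ => (hξ p.1 p.2).comap_le)

lemma stepNoise_le (hξ : ∀ n k, Measurable (ξ (n + 1) k)) (n : ℕ) : stepNoise ξ n ≤ mΩ :=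
  iSup_le fun k => (hξ n k).comap_le

/-! ### Propagation of the energy -/

section Solution

variable {M : ℕ} {s : ℝ → ℝ → ℝ} {s_m s_M : ℝ} {σ : Torus → ℝ} {q : ℕ → Torus → ℝ} {ε Δt : ℝ}
  {ρ : ℕ → ZMod M → Ω → ℝ} {g : ℕ → ZMod M → Ω → L2Vel}

/-- The noise factor at the point `x` in a given step has a version which only depends on the noise
of this step, and its growth factor is controlled in expectation. -/
lemma IsSolution.exists_noiseFactor (h : IsSolution P s σ q ε Δt ξ ρ g) (hΔt : 0 ≤ Δt) {Γ : ℝ}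
    (hΓ : ∀ x, (Summable fun k => q k x ^ 2) ∧ ∑' k, q k x ^ 2 ≤ Γ) (n : ℕ) (x : Torus) :
    ∃ η : Ω → ℝ, StronglyMeasurable[stepNoise ξ n] η ∧
      (∀ᵐ ω ∂P, noiseFactor Δt (fun k => q k x) (fun k => ξ (n + 1) k ω) = η ω) ∧
      ∫⁻ ω, ENNReal.ofReal (growth (η ω)) ∂P ≤ ENNReal.ofReal (Real.exp (5 * Γ * Δt)) := by
  have hind : iIndepFun (fun k => ξ (n + 1) k) P :=
    h.indep.precomp (g := fun k => (n, k)) (Prod.mk_right_injective n)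
  obtain ⟨S, hS, hSeq, hL2, h0, h2⟩ := exists_seriesSum (X := ξ (n + 1)) (h.measurable n)
    (h.gaussian n) hind (hΓ x).1
  have hSm : StronglyMeasurable[stepNoise ξ n] S := hS
  have hηm : StronglyMeasurable[stepNoise ξ n]
      fun ω => 1 / 2 * Δt * (∑' k, q k x ^ 2) + √Δt * S ω :=
    (stronglyMeasurable_const (b := 1 / 2 * Δt * ∑' k, q k x ^ 2)).add (hSm.const_mul √Δt)
  refine ⟨_, hηm, ?_,
    lintegral_growth_le hΔt hL2 h0 h2 (tsum_nonneg fun k => sq_nonneg _) (hΓ x).2⟩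
  filter_upwards [hSeq] with ω hω
  rw [noiseFactor, hω]

variable [NeZero M]

/-- The unknowns after `n` steps agree almost surely with functions of the history, and `gⁿ` has
zero velocity average. -/
lemma IsSolution.exists_adapted (h : IsSolution P s σ q ε Δt ξ ρ g)
    (hs : IsCollisionKernel s s_m s_M) (hσ : ∀ x, 0 ≤ σ x) (hΔt : 0 ≤ Δt) {Γ : ℝ}
    (hΓ : ∀ x, (Summable fun k => q k x ^ 2) ∧ ∑' k, q k x ^ 2 ≤ Γ)
    (hρ0 : ∀ i, StronglyMeasurable[m₀] (ρ 0 i)) (hg0 : ∀ i, StronglyMeasurable[m₀] (g 0 i))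
    (n : ℕ) : ∃ (ρ' : ZMod M → Ω → ℝ) (g' : ZMod M → Ω → L2Vel),
      (∀ i, StronglyMeasurable[history m₀ ξ n] (ρ' i)) ∧
      (∀ i, StronglyMeasurable[history m₀ ξ n] (g' i)) ∧
      ∀ᵐ ω ∂P, (∀ i, ρ n i ω = ρ' i ω) ∧ (∀ i, g n i ω = g' i ω) ∧
        ∀ i, velAvg (g n i ω) = 0 := by
  induction n with
  | zero =>
    refine ⟨ρ 0, g 0, fun i => (hρ0 i).mono le_sup_left, fun i => (hg0 i).mono le_sup_left, ?_⟩
    filter_upwards [ae_all_iff.2 h.initial_mean] with ω hω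
    exact ⟨fun _ => rfl, fun _ => rfl, hω⟩
  | succ n ih =>
    obtain ⟨ρ₁, g₁, hρ₁, hg₁, heq⟩ := ih
    choose η hη hηeq _ using fun x => h.exists_noiseFactor hΔt hΓ n x
    have hη' : ∀ x, StronglyMeasurable[history m₀ ξ (n + 1)] (η x) := fun x =>
      (hη x).mono (stepNoise_le_history n)
    obtain ⟨ρ₂, g₂, hρ₂, hg₂, hstep⟩ := exists_stronglyMeasurable_step (q := q) (ε := ε)
      (ξ := ξ (n + 1)) hs hσ hΔt (fun i => (hρ₁ i).mono (history_le_succ n))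
      (fun i => (hg₁ i).mono (history_le_succ n)) (fun i => hη' (node M i))
      (fun i => hη' (halfNode M i))
    refine ⟨ρ₂, g₂, hρ₂, hg₂, ?_⟩
    filter_upwards [heq, h.step n, ae_all_iff.2 fun i => hηeq (node M i),
      ae_all_iff.2 fun i => hηeq (halfNode M i)] with ω h1 h2 h3 h4
    have hmean := h2.velAvg_eq_zero hs h1.2.2
    simp only [h1.1, h1.2.1] at h2
    obtain ⟨e1, e2⟩ := hstep ω _ _ h2 h3 h4
    exact ⟨e1, e2, hmean⟩

lemma IsSolution.energy_succ_le_of_initial (h : IsSolution P s σ q ε Δt ξ ρ g)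
    (hs : IsCollisionKernel s s_m s_M) {σ_m : ℝ} (hσm : 0 < σ_m) (hσ : ∀ x, σ_m ≤ σ x)
    (hε : 0 < ε) (hΔt : 0 < Δt)
    (hCFL : Δt ≤ 2 * s_m * σ_m * meshSize M ^ 2 / (2 * (2 + ε)) + ε * meshSize M / (2 + ε)) {Γ : ℝ}
    (hΓ : ∀ x, (Summable fun k => q k x ^ 2) ∧ ∑' k, q k x ^ 2 ≤ Γ) (hm₀ : m₀ ≤ mΩ)
    (hρ0 : ∀ i, StronglyMeasurable[m₀] (ρ 0 i)) (hg0 : ∀ i, StronglyMeasurable[m₀] (g 0 i))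
    (hm₀ind : Indep m₀
      (⨆ p : ℕ × ℕ, MeasurableSpace.comap (ξ (p.1 + 1) p.2) inferInstance) P) (n : ℕ) :
    energy P ε (ρ (n + 1)) (g (n + 1))
      ≤ ENNReal.ofReal (Real.exp (5 * Γ * Δt)) * energy P ε (ρ n) (g n) := by
  have hadp := h.exists_adapted hs (fun x => hσm.le.trans (hσ x)) hΔt.le hΓ hρ0 hg0
  have hρm : ∀ n i, AEMeasurable (ρ n i) P := fun n i => by
    obtain ⟨ρ', _, hρ', _, heq⟩ := hadp n
    exact ⟨ρ' i, ((hρ' i).mono (history_le h.measurable hm₀ n)).measurable,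
      heq.mono fun ω hω => hω.1 i⟩
  obtain ⟨ρ', g', hρ', hg', heq⟩ := hadp n
  have hmean : ∀ᵐ ω ∂P, ∀ i, velAvg (g (n + 1) i ω) = 0 := by
    obtain ⟨_, _, _, _, heq'⟩ := hadp (n + 1)
    exact heq'.mono fun ω hω => hω.2.2
  choose η hη hηeq hηle using fun x => h.exists_noiseFactor hΔt.le hΓ n x
  rw [energy_eq_lintegral (hρm (n + 1)), energy_eq_lintegral (hρm n)]
  let A : ZMod M ⊕ ZMod M → Ω → ℝ := Sum.elim (fun i ω => ρ' i ω ^ 2)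
    (fun i ω => ε ^ 2 * velAvg (fun v => g' i ω v ^ 2))
  let G : ZMod M ⊕ ZMod M → Ω → ℝ := Sum.elim (fun i ω => growth (η (node M i) ω))
    (fun i ω => growth (η (halfNode M i) ω))
  have hgrowth : Continuous growth := by unfold growth; fun_prop
  calc ∫⁻ ω, ENNReal.ofReal (∑ i, ρ (n + 1) i ω ^ 2
        + ε ^ 2 * ∑ i, velAvg (fun v => g (n + 1) i ω v ^ 2)) ∂P
      ≤ ∫⁻ ω, ENNReal.ofReal (∑ j, G j ω * A j ω) ∂P := by
        refine lintegral_mono_ae ?_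
        filter_upwards [heq, hmean, h.step n, ae_all_iff.2 fun i => hηeq (node M i),
          ae_all_iff.2 fun i => hηeq (halfNode M i)] with ω h1 h2 h3 h4 h5
        refine ENNReal.ofReal_le_ofReal ((h3.energy_le hs hσm hσ hε hΔt hCFL h2).trans_eq ?_)
        simp only [Fintype.sum_sum_type, A, G, Sum.elim_inl, Sum.elim_inr, h1.1, h1.2.1, h4, h5]
        rw [Finset.mul_sum]
        congr 1
        exact Finset.sum_congr rfl fun i _ => by ring
    _ ≤ ENNReal.ofReal (Real.exp (5 * Γ * Δt)) * ∫⁻ ω, ENNReal.ofReal (∑ j, A j ω) ∂P := by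
        refine lintegral_sum_mul_le (history_le h.measurable hm₀ n) (stepNoise_le h.measurable n)
          (indep_history_stepNoise h.measurable h.indep hm₀ hm₀ind n) ?_ ?_ ?_ ?_ ?_
        · rintro (i | i)
          · exact (hρ' i).pow 2
          · simp only [A, Sum.elim_inr, velAvg_sq]
            exact (((hg' i).norm.pow 2).const_mul _).const_mul _
        · rintro (i | i)
          · exact hgrowth.comp_stronglyMeasurable (hη _)
          · exact hgrowth.comp_stronglyMeasurable (hη _)
        · rintro (i | i) ω
          · exact sq_nonneg _
          · simp only [A, Sum.elim_inr, velAvg_sq]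
            positivity
        · rintro (i | i) ω
          · exact growth_nonneg _
          · exact growth_nonneg _
        · rintro (i | i)
          · exact hηle _
          · exact hηle _
    _ = _ := by
        congr 1
        refine lintegral_congr_ae ?_
        filter_upwards [heq] with ω h1
        simp only [Fintype.sum_sum_type, A, Sum.elim_inl, Sum.elim_inr, h1.1, h1.2.1]
        rw [Finset.mul_sum]

/-- In one step the energy grows at most by the factor `exp (5 Γ Δt)`. -/
lemma IsSolution.energy_succ_le (h : IsSolution P s σ q ε Δt ξ ρ g)
    (hs : IsCollisionKernel s s_m s_M) {σ_m : ℝ} (hσm : 0 < σ_m) (hσ : ∀ x, σ_m ≤ σ x)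
    (hε : 0 < ε) (hΔt : 0 < Δt)
    (hCFL : Δt ≤ 2 * s_m * σ_m * meshSize M ^ 2 / (2 * (2 + ε)) + ε * meshSize M / (2 + ε)) {Γ : ℝ}
    (hΓ : ∀ x, (Summable fun k => q k x ^ 2) ∧ ∑' k, q k x ^ 2 ≤ Γ) (n : ℕ) :
    energy P ε (ρ (n + 1)) (g (n + 1))
      ≤ ENNReal.ofReal (Real.exp (5 * Γ * Δt)) * energy P ε (ρ n) (g n) := by
  obtain ⟨m₀, hm₀, hρ0, hg0, hm₀ind⟩ := h.initial
  exact h.energy_succ_le_of_initial hs hσm hσ hε hΔt hCFL hΓ hm₀ hρ0 hg0 hm₀ind n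

end Solution
end Probability

end KineticScheme

end

theorem theorem2
    (e : HilbertBasis ℕ ℝ KineticScheme.L2Torus)
    (Q : KineticScheme.L2Torus →L[ℝ] KineticScheme.L2Torus)
    (q : ℕ → KineticScheme.Torus → ℝ)
    (hQ : KineticScheme.IsNoiseCoefficient e Q q)
    (T : ℝ) (hT : 0 < T) :
    ∃ C : ℝ≥0,
      ∀ (s : ℝ → ℝ → ℝ) (s_m s_M : ℝ), KineticScheme.IsCollisionKernel s s_m s_M →
      ∀ (σ : KineticScheme.Torus → ℝ) (σ_m σ_M : ℝ), 0 < σ_m →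
        (∀ x, σ_m ≤ σ x ∧ σ x ≤ σ_M) →
      ∀ (ε : ℝ), 0 < ε →
      ∀ (M : ℕ) [NeZero M] (Δt : ℝ), 0 < Δt →
        Δt ≤ 2 * s_m * σ_m * KineticScheme.meshSize M ^ 2 / (2 * (2 + ε))
            + ε * KineticScheme.meshSize M / (2 + ε) →
      ∀ (Ω : Type*) [MeasurableSpace Ω] (P : Measure Ω) [IsProbabilityMeasure P]
        (ξ : ℕ → ℕ → Ω → ℝ) (ρ : ℕ → ZMod M → Ω → ℝ)
        (g : ℕ → ZMod M → Ω → KineticScheme.L2Vel),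
        KineticScheme.IsSolution P s σ q ε Δt ξ ρ g →
      ∀ n : ℕ, (n : ℝ) * Δt ≤ T →
        KineticScheme.energy P ε (ρ n) (g n) ≤ C * KineticScheme.energy P ε (ρ 0) (g 0) := by
  obtain ⟨Γ, hΓ0, hΓ⟩ := hQ.exists_bound
  refine ⟨Real.toNNReal (Real.exp (5 * Γ * T)), ?_⟩
  intro s s_m s_M hs σ σ_m σ_M hσm hσ ε hε M _ Δt hΔt hCFL Ω _ P _ ξ ρ g h n hn
  have hiter : ∀ n : ℕ, KineticScheme.energy P ε (ρ n) (g n)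
      ≤ ENNReal.ofReal (Real.exp (5 * Γ * Δt)) ^ n * KineticScheme.energy P ε (ρ 0) (g 0) := by
    intro n
    induction n with
    | zero => simp
    | succ n ih =>
      calc KineticScheme.energy P ε (ρ (n + 1)) (g (n + 1))
          ≤ ENNReal.ofReal (Real.exp (5 * Γ * Δt)) * KineticScheme.energy P ε (ρ n) (g n) :=
            h.energy_succ_le hs hσm (fun x => (hσ x).1) hε hΔt hCFL hΓ n
        _ ≤ _ := by
            rw [pow_succ', mul_assoc (ENNReal.ofReal _)]
            exact mul_le_mul_right ih _
  refine (hiter n).trans ?_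
  gcongr
  rw [← ENNReal.ofReal_pow (Real.exp_pos _).le, ← Real.exp_nat_mul]
  refine ENNReal.ofReal_le_ofReal (Real.exp_le_exp.2 ?_)
  nlinarith
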